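/- Let $\nu>0$ and $a>3$. Let $v_0:\mathbb R^3\to\mathbb R^3$ be continuously differentiable with $\nabla\cdot v_0=0$ and $|v_0(x)|+|\nabla v_0(x)|\le C(1+|x|)^{-a}$ for some $C$. Let $f(x,t)$, $x\in\mathbb R^3$, $t\ge 0$, be a measurable $\mathbb R^3$-valued function, differentiable in $x$, such that for every $T>0$ there is a $C_T$ with $|f(x,t)|+|\nabla f(x,t)|\le C_T(1+|x|)^{-a}$ for all $x\in\mathbb R^3$, $t\in[0,T]$. For $t>0$ put $$g(x,t)=\frac{e^{-|x|^2/(4\nu t)}}{(4\nu t\pi)^{3/2}},\qquad G_{jm}(x,t)=\delta_{jm}\,g(x,t)+\frac1{2\pi^{3/2}}\frac{\partial^2}{\partial x_j\partial x_m}\Big(\frac1{|x|}\int_0^{|x|/\sqrt{4\nu t}}e^{-s^2}ds\Big),\quad 1\le j,m\le 3 .$$ A solution on $[0,T]$ of the Navier–Stokes problem $$v_t+(v\cdot\nabla)v=-\nabla p+\nu\Delta v+f,\qquad \nabla\cdot v=0,\qquad v(x,0)=v_0(x)$$ is, by definition, a solution $v$ of the integral equation $$v(x,t)=\int_0^t\!ds\int_{\mathbb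 R^3}G(x-y,t-s)\,[f-(v\cdot\nabla)v](y,s)\,dy+\int_{\mathbb R^3}g(x-y,t)\,v_0(y)\,dy,\qquad x\in\mathbb R^3,\ t\in[0,T],$$ where the space-time integral converges absolutely and the last term is read as $v_0(x)$ at $t=0$; a solution for all $t\ge0$ is a $v$ that is a solution on $[0,T]$ for every $T>0$. Let $X_T$ be the class of vector functions $v(x,t)$ that are continuously differentiable in $x$ for every $t\in[0,T]$ and have finite $$N_1(v)=N_{1,T}(v)=\sup_{x\in\mathbb R^3,\ t\in[0,T]}(|v(x,t)|+|\nabla v(x,t)|)(1+|x|).$$ Define the iterations by $$v_1=F,\qquad v_{n+1}(x,t)=-\int_0^t\!ds\int_{\mathbb R^3}G(x-y,t-s)\,[(v_n\cdot\nabla)v_n](y,s)\,dy+F(x,t),$$ $$F(x,t)=\int_0^t\!ds\int_{\mathbb R^3}G(x-y,t-s)f(y,s)\,dy+\int_{\mathbb R^3}g(x-y,t)v_0(y)\,dy .$$ Theorem 1. (i) For every $T>0$ the problem has at most one solution on $[0,T]$ in $X_T$. (ii) If $T>0$ and $\sup_n N_{1,T}(v_n)<\infty$, then there is a solution $v\in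 X_T$ on $[0,T]$, and it is the limit of the iterations: $\sup_{x\in\mathbb R^3,\,t\in[0,T]}(|v_n-v|+|\nabla(v_n-v)|)\to0$. If $\sup_nN_{1,T}(v_n)<\infty$ for every $T>0$, then there is a solution $v$ for all $t\ge0$, with $v\in X_T$ for every $T>0$; the iterations converge to it in the same sense on every $[0,T]$, and its energy $E(t)=\int_{\mathbb R^3}|v(x,t)|^2dx$ is finite for every $t\ge0$. (iii) Every solution on $[0,T]$ in $X_T$ has finite energy $E(t)$ for every $t\in[0,T]$. -/

import Mathlib

open MeasureTheory Set Filter Topology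
open scoped ENNReal

noncomputable section

namespace NavierStokes

/-- Physical space `ℝ³` with the Euclidean norm. -/
abbrev E3 : Type := EuclideanSpace ℝ (Fin 3)

/-- The standard basis vectors of `ℝ³`. -/
def basisVec (j : Fin 3) : E3 := EuclideanSpace.single j 1

/-- The divergence of a vector field on `ℝ³`. -/
def divergence (u : E3 → E3) (x : E3) : ℝ :=
  ∑ j : Fin 3, (fderiv ℝ u x (basisVec j)) j

/-- The convective term `(u · ∇) u = ∑ⱼ uⱼ ∂ⱼ u`. -/
def convection (u : E3 → E3) (x : E3) : E3 :=
  fderiv ℝ u x (u x)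

/-- The heat kernel `g(x,t) = exp (-|x|²/(4νt)) / (4νtπ)^(3/2)`, for `t > 0`. -/
def heatKernel (ν t : ℝ) (x : E3) : ℝ :=
  Real.exp (-‖x‖ ^ 2 / (4 * ν * t)) / (4 * ν * t * Real.pi) ^ ((3 : ℝ) / 2)

/-- The function `(1/|x|) ∫₀^{|x|/√(4νt)} exp (-s²) ds`, for `t > 0`, with its limit value
`1/√(4νt)` at the removable singularity `x = 0`. -/
def errorPotential (ν t : ℝ) (x : E3) : ℝ :=
  if x = 0 then 1 / Real.sqrt (4 * ν * t)
  else (1 / ‖x‖) * ∫ s in (0 : ℝ)..(‖x‖ / Real.sqrt (4 * ν * t)), Real.exp (-s ^ 2)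

/-- The kernel `G_{jm}(x,t) = δ_{jm} g(x,t) + (2 π^{3/2})⁻¹ ∂ⱼ∂ₘ ((1/|x|) ∫₀^{|x|/√(4νt)} exp (-s²) ds)`,
for `t > 0`. -/
def kernelG (ν : ℝ) (j m : Fin 3) (t : ℝ) (x : E3) : ℝ :=
  (if j = m then heatKernel ν t x else 0) +
    1 / (2 * Real.pi ^ ((3 : ℝ) / 2)) *
      fderiv ℝ (fun z => fderiv ℝ (errorPotential ν t) z (basisVec m)) x (basisVec j)

/-- The matrix `G(x,t)` applied to a vector: `(G h)ⱼ = ∑ₘ G_{jm} hₘ`. -/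
def applyG (ν t : ℝ) (x : E3) (h : E3) : E3 :=
  WithLp.toLp 2 (fun j => ∑ m : Fin 3, kernelG ν j m t x * h m)

/-- `∫₀ᵗ ds ∫ G(x-y,t-s) h(y,s) dy`. -/
def duhamel (ν : ℝ) (h : ℝ → E3 → E3) (t : ℝ) (x : E3) : E3 :=
  ∫ s in (0 : ℝ)..t, ∫ y : E3, applyG ν (t - s) (x - y) (h s y)

/-- Absolute convergence of the space-time integral `∫₀ᵗ ds ∫ G(x-y,t-s) h(y,s) dy`. -/
def DuhamelConverges (ν : ℝ) (h : ℝ → E3 → E3) (t : ℝ) (x : E3) : Prop :=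
  Integrable (fun p : ℝ × E3 => applyG ν (t - p.1) (x - p.2) (h p.1 p.2))
    ((volume.restrict (Ioc 0 t)).prod volume)

/-- `∫ g(x-y,t) v₀(y) dy`; at `t = 0` the kernel is the delta function. -/
def heatFlow (ν : ℝ) (v₀ : E3 → E3) (t : ℝ) (x : E3) : E3 :=
  if t = 0 then v₀ x else ∫ y : E3, heatKernel ν t (x - y) • v₀ y

/-- `v` solves, for all `x` and all `t ∈ [0,T]`, the integral equation
`v(x,t) = ∫₀ᵗ ds ∫ G(x-y,t-s) [f - (v·∇)v](y,s) dy + ∫ g(x-y,t) v₀(y) dy`,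
the space-time integral being absolutely convergent. -/
def SolvesOn (ν : ℝ) (f : ℝ → E3 → E3) (v₀ : E3 → E3) (T : ℝ) (v : ℝ → E3 → E3) : Prop :=
  ∀ t ∈ Icc (0 : ℝ) T, ∀ x : E3,
    DuhamelConverges ν (fun s y => f s y - convection (v s) y) t x ∧
    v t x = duhamel ν (fun s y => f s y - convection (v s) y) t x + heatFlow ν v₀ t x

/-- `N₀(v) = sup_{x, t ∈ [0,T]} (|v| + |∇v|)`. -/
def N0 (T : ℝ) (v : ℝ → E3 → E3) : ℝ≥0∞ :=
  ⨆ t ∈ Icc (0 : ℝ) T, ⨆ x : E3, ENNReal.ofReal (‖v t x‖ + ‖fderiv ℝ (v t) x‖)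

/-- `N₁(v) = sup_{x, t ∈ [0,T]} (|v| + |∇v|) (1 + |x|)`. -/
def N1 (T : ℝ) (v : ℝ → E3 → E3) : ℝ≥0∞ :=
  ⨆ t ∈ Icc (0 : ℝ) T, ⨆ x : E3,
    ENNReal.ofReal ((‖v t x‖ + ‖fderiv ℝ (v t) x‖) * (1 + ‖x‖))

/-- The class `X` on the time interval `[0,T]`: vector functions that are continuously
differentiable in `x` and have finite `N₁`. -/
def InX (T : ℝ) (v : ℝ → E3 → E3) : Prop :=
  (∀ t ∈ Icc (0 : ℝ) T, ContDiff ℝ 1 (v t)) ∧ N1 T v < ⊤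

/-- `F(x,t) = ∫₀ᵗ ds ∫ G(x-y,t-s) f(y,s) dy + ∫ g(x-y,t) v₀(y) dy`. -/
def sourceF (ν : ℝ) (f : ℝ → E3 → E3) (v₀ : E3 → E3) (t : ℝ) (x : E3) : E3 :=
  duhamel ν f t x + heatFlow ν v₀ t x

/-- The iterations: the first one is `F`, and each next one is
`F - ∫₀ᵗ ds ∫ G(x-y,t-s) (vₙ·∇)vₙ dy`. The numbering starts at `0`. -/
def iter (ν : ℝ) (f : ℝ → E3 → E3) (v₀ : E3 → E3) : ℕ → ℝ → E3 → E3
  | 0 => sourceF ν f v₀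
  | n + 1 => fun t x =>
      -duhamel ν (fun s y => convection (iter ν f v₀ n s) y) t x + sourceF ν f v₀ t x

/-- The energy `E(t) = ∫ |v(x,t)|² dx`, with values in `[0,∞]`. -/
def energy (v : ℝ → E3 → E3) (t : ℝ) : ℝ≥0∞ :=
  ∫⁻ x : E3, ENNReal.ofReal (‖v t x‖ ^ 2)

end NavierStokes

end

noncomputable section

namespace NavierStokes

/-! With `l = 1/√(4νt)`, both kernels have the form `l³ K(lx)` for a fixed matrix profile `K`. For
the Oseen kernel `G` this comes from rewriting the error-function potential as `l M₀(l²|x|²)`, where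
`Mₖ(q) = ∫₀¹ u^(2k) exp(-q u²) du`. This is smooth through the origin, satisfies `Mₖ' = -Mₖ₊₁`, and
decays like `q^(-k-1/2)`. Hence `|K| ≲ (1+|z|)⁻³` and `|∇K| ≲ (1+|z|)⁻⁴`, so the kernel and its
gradient are bounded by the third and fourth powers of the weight `(l⁻¹+|z|)⁻¹`.

A third power just fails to be integrable at infinity, but one power of decay in the density repairs
this. If `|h(y)| ≤ A/(1+|y|)`, then the convolution and its gradient are `O(A(1+l))`. At lag `t-s`
one has `l ~ (t-s)^(-1/2)`, which is integrable in time. The derivative always falls on the kernel,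
so one derivative of the Duhamel integral is controlled without differentiating the density.

For two fields bounded in `N₁` by `B`, the difference of the convective terms is at most `B/(1+|y|)`
times the unweighted `C¹` distance: one factor supplies the spatial decay, the other is the
difference. Measuring that distance against `exp(μt)` with `μ` large makes the Duhamel map a
contraction by `1/2` on all of `[0,T]` at once (`exists_contraction_rate`, `closeBy_of_eq_duhamel`).
Uniqueness follows by applying it repeatedly to two solutions.

For existence, the assumed `N₁` bound makes consecutive iterates approach each other geometrically
in this norm. The limit is `C¹` (`limit_regular`), inherits the `N₁` bound pointwise, and solves the
equation because the same estimate gives convergence of the Duhamel terms (`iterLimit_spec`). It is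
a pointwise limit that does not depend on `T`, so a single field serves every interval.

For the energy, the full source `f - (v·∇)v` decays like `(1+|y|)⁻²`. Convolution with a kernel of
order three keeps decay of any order below two; the order `7/4` exceeds `3/2`, which gives square
integrability on `ℝ³`. -/

/-! ### Gaussian moments on the unit interval. -/

/-- The moment `∫₀¹ u^(2k) exp (-q u²) du`. -/
def gaussMoment (k : ℕ) (q : ℝ) : ℝ :=
  ∫ u in (0 : ℝ)..1, u ^ (2 * k) * Real.exp (-q * u ^ 2)

lemma hasDerivAt_gaussMoment (k : ℕ) (q : ℝ) :
    HasDerivAt (gaussMoment k) (-gaussMoment (k + 1) q) q := by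
  have h := (intervalIntegral.hasDerivAt_integral_of_dominated_loc_of_deriv_le (μ := volume)
    (a := 0) (b := 1) (x₀ := q) (s := Metric.ball q 1)
    (F := fun q u => u ^ (2 * k) * Real.exp (-q * u ^ 2))
    (F' := fun q u => -(u ^ (2 * (k + 1)) * Real.exp (-q * u ^ 2)))
    (bound := fun _ => Real.exp (|q| + 1)) (Metric.ball_mem_nhds q one_pos)
    (Eventually.of_forall fun x => Continuous.aestronglyMeasurable (by fun_prop))
    (Continuous.intervalIntegrable (by fun_prop) _ _)
    (Continuous.aestronglyMeasurable (by fun_prop))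
    (ae_of_all _ fun u hu x hx => ?_)
    (Continuous.intervalIntegrable (by fun_prop) _ _)
    (ae_of_all _ fun u _ x _ => ?_)).2
  · rw [intervalIntegral.integral_neg] at h
    exact h
  · rw [uIoc_of_le zero_le_one] at hu
    have hu2 : u ^ 2 ≤ 1 := pow_le_one₀ hu.1.le hu.2
    rw [norm_neg, norm_mul, norm_pow, Real.norm_eq_abs, Real.norm_eq_abs, Real.abs_exp,
      abs_of_pos hu.1, ← one_mul (Real.exp (|q| + 1))]
    have hx' : |x| ≤ |q| + 1 := by
      have := abs_sub_abs_le_abs_sub x q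
      rw [Metric.mem_ball, Real.dist_eq] at hx
      linarith
    refine mul_le_mul (pow_le_one₀ hu.1.le hu.2) (Real.exp_le_exp.2 ?_) (Real.exp_pos _).le
      zero_le_one
    calc -x * u ^ 2 ≤ |x| * u ^ 2 := by gcongr; exact neg_le_abs x
      _ ≤ |x| * 1 := by gcongr
      _ ≤ |q| + 1 := by linarith
  · have h1 : HasDerivAt (fun x : ℝ => -x * u ^ 2) (-1 * u ^ 2) x :=
      ((hasDerivAt_id x).neg).mul_const _
    convert! h1.exp.const_mul (u ^ (2 * k)) using 1
    ring

lemma contDiff_gaussMoment (k : ℕ) : ContDiff ℝ 1 (gaussMoment k) := by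
  rw [contDiff_one_iff_deriv]
  refine ⟨fun q => (hasDerivAt_gaussMoment k q).differentiableAt, ?_⟩
  rw [show deriv (gaussMoment k) = fun q => -gaussMoment (k + 1) q from
    funext fun q => (hasDerivAt_gaussMoment k q).deriv]
  exact (continuous_iff_continuousAt.2
    fun q => (hasDerivAt_gaussMoment (k + 1) q).continuousAt).neg

lemma gaussMoment_nonneg (k : ℕ) (q : ℝ) : 0 ≤ gaussMoment k q :=
  intervalIntegral.integral_nonneg zero_le_one fun u hu => by
    have := hu.1
    positivity

/-- On `[0,1]`, `exp(-q u²) ≤ e · exp(-(1+q)u²)`. After this shift the integral extends to the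
half-line, where it is a Gamma integral that stays finite at `q = 0`. -/
lemma gaussMoment_le (k : ℕ) :
    ∃ C, 0 ≤ C ∧ ∀ q, 0 ≤ q → gaussMoment k q ≤ C * (1 + q) ^ (-(k + 1 / 2 : ℝ)) := by
  refine ⟨Real.exp 1 * (1 / 2 * Real.Gamma ((2 * k + 1) / 2)), ?_, fun q hq => ?_⟩
  · have := Real.Gamma_pos_of_pos (show (0 : ℝ) < (2 * k + 1) / 2 by positivity)
    positivity
  have key := integral_rpow_mul_exp_neg_mul_rpow (p := 2) (q := 2 * k) (b := 1 + q) two_pos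
    (by have : (0 : ℝ) ≤ 2 * k := by positivity
        linarith) (by linarith)
  have hint : IntegrableOn (fun x : ℝ => x ^ (2 * k : ℝ) * Real.exp (-(1 + q) * x ^ (2 : ℝ)))
      (Ioi 0) := by
    refine Integrable.of_integral_ne_zero ?_
    rw [key]
    have := Real.Gamma_pos_of_pos (show (0 : ℝ) < (2 * k + 1) / 2 by positivity)
    positivity
  calc gaussMoment k q
      = ∫ u in Ioc (0 : ℝ) 1, u ^ (2 * k) * Real.exp (-q * u ^ 2) := by
        rw [gaussMoment, intervalIntegral.integral_of_le zero_le_one]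
    _ ≤ ∫ u in Ioc (0 : ℝ) 1,
          Real.exp 1 * (u ^ (2 * k : ℝ) * Real.exp (-(1 + q) * u ^ (2 : ℝ))) := by
        refine setIntegral_mono_on ?_ ?_ measurableSet_Ioc fun u hu => ?_
        · exact (Continuous.integrableOn_Icc (by fun_prop)).mono_set Ioc_subset_Icc_self
        · exact (hint.mono_set Ioc_subset_Ioi_self).const_mul _
        · have e1 : u ^ (2 * k : ℝ) = u ^ (2 * k) := by exact_mod_cast Real.rpow_natCast u (2 * k)
          have e2 : u ^ (2 : ℝ) = u ^ 2 := by exact_mod_cast Real.rpow_natCast u 2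
          rw [e1, e2, mul_left_comm, ← Real.exp_add]
          have hu2 : u ^ 2 ≤ 1 := pow_le_one₀ hu.1.le hu.2
          have := hu.1
          gcongr
          linarith
    _ = Real.exp 1 * ∫ u in Ioc (0 : ℝ) 1,
          (u ^ (2 * k : ℝ) * Real.exp (-(1 + q) * u ^ (2 : ℝ))) := integral_const_mul _ _
    _ ≤ Real.exp 1 * ∫ u in Ioi (0 : ℝ),
          (u ^ (2 * k : ℝ) * Real.exp (-(1 + q) * u ^ (2 : ℝ))) := by
        refine mul_le_mul_of_nonneg_left ?_ (Real.exp_pos _).le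
        refine setIntegral_mono_set hint ?_ Ioc_subset_Ioi_self.eventuallyLE
        filter_upwards [ae_restrict_mem measurableSet_Ioi] with u hu
        have : (0 : ℝ) < u := hu
        positivity
    _ = _ := by
        rw [key, show -(2 * k + 1 : ℝ) / 2 = -(k + 1 / 2 : ℝ) by ring]
        ring

/-! ### Decay of the two matrix profiles. -/

/-- The heat flow profile: a multiple of the Gaussian. -/
def heatProfile (z : E3) : E3 →L[ℝ] E3 :=
  (1 / Real.pi ^ ((3 : ℝ) / 2) * Real.exp (-‖z‖ ^ 2)) • ContinuousLinearMap.id ℝ E3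

/-- The rank one map `w ↦ ⟨z, w⟩ z`. -/
def dyad (z : E3) : E3 →L[ℝ] E3 :=
  ContinuousLinearMap.smulRightL ℝ E3 E3 (innerSL ℝ z) z

lemma dyad_apply (z w : E3) : dyad z w = inner ℝ z w • z := rfl

/-- The coefficient of the identity in `oseenProfile`. -/
def idCoeff (q : ℝ) : ℝ :=
  1 / Real.pi ^ ((3 : ℝ) / 2) * (Real.exp (-q) - gaussMoment 1 q)

/-- The coefficient of `dyad` in `oseenProfile`. -/
def dyadCoeff (q : ℝ) : ℝ :=
  2 / Real.pi ^ ((3 : ℝ) / 2) * gaussMoment 2 q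

/-- The kernel matrix `G` at the time `t` with `4νt = 1`. -/
def oseenProfile (z : E3) : E3 →L[ℝ] E3 :=
  idCoeff (‖z‖ ^ 2) • ContinuousLinearMap.id ℝ E3 + dyadCoeff (‖z‖ ^ 2) • dyad z

lemma hasFDerivAt_dyad (z : E3) :
    ∃ D : E3 →L[ℝ] E3 →L[ℝ] E3, HasFDerivAt dyad D z ∧ ‖D‖ ≤ 2 * ‖z‖ := by
  have h := (ContinuousLinearMap.smulRightL ℝ E3 E3).hasFDerivAt_of_bilinear
    (innerSL ℝ (E := E3)).hasFDerivAt (hasFDerivAt_id z)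
  refine ⟨_, h, ContinuousLinearMap.opNorm_le_bound _ (by positivity) fun w => ?_⟩
  refine ContinuousLinearMap.opNorm_le_bound _ (by positivity) fun y => ?_
  have e : ‖inner ℝ z y • w + inner ℝ w y • z‖ ≤ 2 * ‖z‖ * ‖w‖ * ‖y‖ := by
    refine (norm_add_le _ _).trans ?_
    rw [norm_smul, norm_smul]
    have h1 := norm_inner_le_norm (𝕜 := ℝ) z y
    have h2 := norm_inner_le_norm (𝕜 := ℝ) w y
    nlinarith [mul_le_mul_of_nonneg_right h1 (norm_nonneg w),
      mul_le_mul_of_nonneg_right h2 (norm_nonneg z)]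
  exact e

lemma norm_dyad_le (z : E3) : ‖dyad z‖ ≤ ‖z‖ ^ 2 := by
  refine ContinuousLinearMap.opNorm_le_bound _ (by positivity) fun y => ?_
  rw [dyad_apply, norm_smul]
  have h1 := norm_inner_le_norm (𝕜 := ℝ) z y
  nlinarith [mul_le_mul_of_nonneg_right h1 (norm_nonneg z)]

lemma hasFDerivAt_radial {φ : ℝ → ℝ} {φ' : ℝ} {z : E3} (h : HasDerivAt φ φ' (‖z‖ ^ 2)) :
    HasFDerivAt (fun y : E3 => φ (‖y‖ ^ 2)) (φ' • (2 • innerSL ℝ z)) z :=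
  h.comp_hasFDerivAt z (hasStrictFDerivAt_norm_sq z).hasFDerivAt

/-- Regularity and decay, of the Oseen tensor's order, of a matrix kernel on `ℝ³`. -/
structure IsDecayingProfile (K : E3 → E3 →L[ℝ] E3) (C : ℝ) : Prop where
  contDiff : ContDiff ℝ 1 K
  norm_le : ∀ z, ‖K z‖ ≤ C * (1 + ‖z‖) ^ (-3 : ℝ)
  norm_fderiv_le : ∀ z, ‖fderiv ℝ K z‖ ≤ C * (1 + ‖z‖) ^ (-4 : ℝ)

/-- The decay of order `s` of the function `φ` of `q = |z|²` and of its derivative. -/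
structure IsDecayingCoeff (φ φ' : ℝ → ℝ) (s C : ℝ) : Prop where
  hasDerivAt : ∀ q, HasDerivAt φ (φ' q) q
  continuous : Continuous φ'
  nonneg : 0 ≤ C
  abs_le : ∀ z : E3, |φ (‖z‖ ^ 2)| ≤ C * (1 + ‖z‖) ^ (-s)
  abs_deriv_le : ∀ z : E3, |φ' (‖z‖ ^ 2)| ≤ C * (1 + ‖z‖) ^ (-s - 2)

lemma one_add_sq_rpow_le {s : ℝ} (hs : 0 ≤ s) {x : ℝ} (hx : 0 ≤ x) :
    (1 + x ^ 2) ^ (-(s / 2)) ≤ 2 ^ (s / 2) * (1 + x) ^ (-s) := by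
  have h1 : (1 + x) ^ 2 / 2 ≤ 1 + x ^ 2 := by nlinarith [sq_nonneg (1 - x)]
  calc (1 + x ^ 2) ^ (-(s / 2)) ≤ ((1 + x) ^ 2 / 2) ^ (-(s / 2)) :=
        Real.rpow_le_rpow_of_nonpos (by positivity) h1 (by linarith)
    _ = 2 ^ (s / 2) * (1 + x) ^ (-s) := by
        rw [Real.div_rpow (by positivity) (by norm_num), Real.rpow_neg (x := 2) (by norm_num),
          div_inv_eq_mul, mul_comm, ← Real.rpow_natCast, ← Real.rpow_mul (by positivity)]
        congr 2
        push_cast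
        ring

/-- Since `q = |z|²`, the decay `q^(-k-1/2)` has order `2k+1` in `|z|`. Thus `M₁` has the order 3
required of the coefficient of the identity, and `M₂` has order 5, which the quadratic `dyad` lowers
to 3. -/
lemma isDecayingCoeff_gaussMoment (k : ℕ) :
    ∃ C, IsDecayingCoeff (gaussMoment k) (fun q => -gaussMoment (k + 1) q) (2 * k + 1) C := by
  obtain ⟨C₁, h0₁, h₁⟩ := gaussMoment_le k
  obtain ⟨C₂, h0₂, h₂⟩ := gaussMoment_le (k + 1)
  refine ⟨C₁ * 2 ^ ((2 * k + 1 : ℝ) / 2) + C₂ * 2 ^ ((2 * k + 3 : ℝ) / 2),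
    hasDerivAt_gaussMoment k, (contDiff_gaussMoment (k + 1)).continuous.neg, by positivity,
    fun z => ?_, fun z => ?_⟩
  · rw [abs_of_nonneg (gaussMoment_nonneg _ _)]
    refine (h₁ _ (by positivity)).trans ?_
    have := one_add_sq_rpow_le (s := 2 * k + 1) (by positivity) (norm_nonneg z)
    rw [show (k + 1 / 2 : ℝ) = (2 * k + 1) / 2 by ring]
    have h3 : 0 ≤ C₂ * 2 ^ ((2 * k + 3 : ℝ) / 2) * (1 + ‖z‖) ^ (-(2 * k + 1 : ℝ)) := by positivity
    nlinarith [mul_le_mul_of_nonneg_left this h0₁]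
  · rw [abs_neg, abs_of_nonneg (gaussMoment_nonneg _ _)]
    refine (h₂ _ (by positivity)).trans ?_
    have := one_add_sq_rpow_le (s := 2 * k + 3) (by positivity) (norm_nonneg z)
    rw [show ((k + 1 : ℕ) + 1 / 2 : ℝ) = (2 * k + 3) / 2 by push_cast; ring,
      show (-(2 * k + 1) - 2 : ℝ) = -(2 * k + 3) by ring]
    have h3 : 0 ≤ C₁ * 2 ^ ((2 * k + 1 : ℝ) / 2) * (1 + ‖z‖) ^ (-(2 * k + 3 : ℝ)) := by positivity
    nlinarith [mul_le_mul_of_nonneg_left this h0₂]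

lemma isDecayingCoeff_exp :
    ∃ C, IsDecayingCoeff (fun q => Real.exp (-q)) (fun q => -Real.exp (-q)) 3 C := by
  -- Order 5 is what the derivative bound asks for when `s = 3`. It follows from `w⁵/5! ≤ exp w` at
  -- `w = 1+|z|` and `1+|z| ≤ 2+|z|²`.
  have key : ∀ z : E3, Real.exp (-‖z‖ ^ 2) ≤ 120 * Real.exp 2 * (1 + ‖z‖) ^ (-5 : ℝ) := by
    intro z
    have h1 := Real.pow_div_factorial_le_exp (1 + ‖z‖) (by positivity) 5
    have h2 : Real.exp (1 + ‖z‖) ≤ Real.exp 2 * Real.exp (‖z‖ ^ 2) := by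
      rw [← Real.exp_add]
      exact Real.exp_le_exp.2 (by nlinarith [sq_nonneg (‖z‖ - 1)])
    rw [div_le_iff₀ (by positivity), show ((Nat.factorial 5 : ℕ) : ℝ) = 120 by
      norm_num [Nat.factorial]] at h1
    rw [Real.rpow_neg (by positivity), ← div_eq_mul_inv, le_div_iff₀ (by positivity),
      Real.exp_neg, inv_mul_le_iff₀ (Real.exp_pos _)]
    have e : (1 + ‖z‖) ^ (5 : ℝ) = (1 + ‖z‖) ^ 5 := by exact_mod_cast Real.rpow_natCast _ 5
    rw [e]
    linarith
  refine ⟨120 * Real.exp 2, fun q => ?_, by fun_prop, by positivity, fun z => ?_, fun z => ?_⟩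
  · simpa using (hasDerivAt_id q).neg.exp
  · rw [Real.abs_exp]
    refine (key z).trans ?_
    gcongr
    · linarith [norm_nonneg z]
    · norm_num
  · rw [abs_neg, Real.abs_exp]
    refine (key z).trans (le_of_eq ?_)
    norm_num

lemma IsDecayingCoeff.const_mul {φ φ' : ℝ → ℝ} {s C : ℝ} (h : IsDecayingCoeff φ φ' s C) (c : ℝ) :
    IsDecayingCoeff (fun q => c * φ q) (fun q => c * φ' q) s (|c| * C) where
  hasDerivAt q := (h.hasDerivAt q).const_mul c
  continuous := h.continuous.const_mul c
  nonneg := mul_nonneg (abs_nonneg _) h.nonneg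
  abs_le z := by
    rw [abs_mul, mul_assoc]
    gcongr
    exact h.abs_le z
  abs_deriv_le z := by
    rw [abs_mul, mul_assoc]
    gcongr
    exact h.abs_deriv_le z

lemma IsDecayingCoeff.sub {φ φ' ψ ψ' : ℝ → ℝ} {s C D : ℝ} (h : IsDecayingCoeff φ φ' s C)
    (k : IsDecayingCoeff ψ ψ' s D) :
    IsDecayingCoeff (fun q => φ q - ψ q) (fun q => φ' q - ψ' q) s (C + D) where
  hasDerivAt q := (h.hasDerivAt q).sub (k.hasDerivAt q)
  continuous := h.continuous.sub k.continuous
  nonneg := add_nonneg h.nonneg k.nonneg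
  abs_le z := by
    rw [add_mul]
    exact (abs_sub _ _).trans (add_le_add (h.abs_le z) (k.abs_le z))
  abs_deriv_le z := by
    rw [add_mul]
    exact (abs_sub _ _).trans (add_le_add (h.abs_deriv_le z) (k.abs_deriv_le z))

lemma IsDecayingCoeff.contDiff {φ φ' : ℝ → ℝ} {s C : ℝ} (h : IsDecayingCoeff φ φ' s C) :
    ContDiff ℝ 1 (fun z : E3 => φ (‖z‖ ^ 2)) := by
  have : ContDiff ℝ 1 φ := by
    rw [contDiff_one_iff_deriv]
    refine ⟨fun q => (h.hasDerivAt q).differentiableAt, ?_⟩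
    rw [show deriv φ = φ' from funext fun q => (h.hasDerivAt q).deriv]
    exact h.continuous
  exact this.comp (contDiff_norm_sq ℝ)

lemma IsDecayingCoeff.hasFDerivAt {φ φ' : ℝ → ℝ} {s C : ℝ} (h : IsDecayingCoeff φ φ' s C)
    (z : E3) : ∃ D : E3 →L[ℝ] ℝ, HasFDerivAt (fun z : E3 => φ (‖z‖ ^ 2)) D z ∧
      ‖D‖ ≤ 2 * C * (1 + ‖z‖) ^ (-s - 1) := by
  refine ⟨_, hasFDerivAt_radial (h.hasDerivAt _), ?_⟩
  have h1 := h.abs_deriv_le z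
  have h2 : ‖(2 • innerSL ℝ z : E3 →L[ℝ] ℝ)‖ ≤ 2 * (1 + ‖z‖) := by
    refine (norm_nsmul_le).trans ?_
    rw [innerSL_apply_norm, Nat.cast_ofNat]
    linarith
  calc ‖φ' (‖z‖ ^ 2) • (2 • innerSL ℝ z : E3 →L[ℝ] ℝ)‖
      ≤ C * (1 + ‖z‖) ^ (-s - 2) * (2 * (1 + ‖z‖)) := by
        rw [norm_smul, Real.norm_eq_abs]
        have := h.nonneg
        gcongr
    _ = 2 * C * ((1 + ‖z‖) ^ (-s - 2) * (1 + ‖z‖) ^ (1 : ℝ)) := by rw [Real.rpow_one]; ring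
    _ = _ := by rw [← Real.rpow_add (by positivity)]; ring_nf

lemma IsDecayingCoeff.isDecayingProfile_id {φ φ' : ℝ → ℝ} {C : ℝ}
    (h : IsDecayingCoeff φ φ' 3 C) :
    IsDecayingProfile (fun z => φ (‖z‖ ^ 2) • ContinuousLinearMap.id ℝ E3) (2 * C) where
  contDiff := h.contDiff.smul contDiff_const
  norm_le z := by
    rw [norm_smul, Real.norm_eq_abs]
    have h1 := h.abs_le z
    have h2 := ContinuousLinearMap.norm_id_le (𝕜 := ℝ) (E := E3)
    have := mul_le_mul h1 h2 (norm_nonneg _) ((abs_nonneg _).trans h1)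
    linarith [abs_nonneg (φ (‖z‖ ^ 2))]
  norm_fderiv_le z := by
    obtain ⟨D, hD, hDn⟩ := h.hasFDerivAt z
    rw [(hD.smul_const (ContinuousLinearMap.id ℝ E3)).fderiv]
    have h2 := ContinuousLinearMap.norm_id_le (𝕜 := ℝ) (E := E3)
    calc _ ≤ ‖D‖ * 1 := by
          rw [ContinuousLinearMap.norm_smulRight_apply]
          gcongr
      _ ≤ _ := by
          rw [mul_one]
          convert! hDn using 2
          norm_num

lemma IsDecayingCoeff.isDecayingProfile_dyad {φ φ' : ℝ → ℝ} {C : ℝ}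
    (h : IsDecayingCoeff φ φ' 5 C) :
    IsDecayingProfile (fun z => φ (‖z‖ ^ 2) • dyad z) (4 * C) where
  contDiff := h.contDiff.smul
    ((ContinuousLinearMap.smulRightL ℝ E3 E3).isBoundedBilinearMap.contDiff.comp
      ((innerSL ℝ (E := E3)).contDiff.prodMk contDiff_id))
  norm_le z := by
    rw [norm_smul, Real.norm_eq_abs]
    have h0 := h.nonneg
    calc |φ (‖z‖ ^ 2)| * ‖dyad z‖ ≤ C * (1 + ‖z‖) ^ (-5 : ℝ) * (1 + ‖z‖) ^ 2 := by
          gcongr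
          · exact h.abs_le z
          · exact (norm_dyad_le z).trans (by gcongr; linarith)
      _ = C * ((1 + ‖z‖) ^ (-5 : ℝ) * (1 + ‖z‖) ^ (2 : ℝ)) := by norm_cast; ring
      _ = C * (1 + ‖z‖) ^ (-3 : ℝ) := by rw [← Real.rpow_add (by positivity)]; norm_num
      _ ≤ _ := by gcongr; linarith
  norm_fderiv_le z := by
    obtain ⟨D, hD, hDn⟩ := h.hasFDerivAt z
    obtain ⟨D', hD', hDn'⟩ := hasFDerivAt_dyad z
    have h0 := h.nonneg
    rw [(hD.fun_smul hD').fderiv]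
    calc _ ≤ |φ (‖z‖ ^ 2)| * ‖D'‖ + ‖D‖ * ‖dyad z‖ := by
          refine (ContinuousLinearMap.opNorm_add_le _ _).trans ?_
          rw [norm_smul, ContinuousLinearMap.norm_smulRight_apply, Real.norm_eq_abs]
      _ ≤ C * (1 + ‖z‖) ^ (-5 : ℝ) * (2 * (1 + ‖z‖))
          + 2 * C * (1 + ‖z‖) ^ (-5 - 1 : ℝ) * (1 + ‖z‖) ^ 2 := by
          gcongr
          · exact h.abs_le z
          · linarith
          · exact (norm_dyad_le z).trans (by gcongr; linarith)
      _ = 2 * C * ((1 + ‖z‖) ^ (-5 : ℝ) * (1 + ‖z‖) ^ (1 : ℝ))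
          + 2 * C * ((1 + ‖z‖) ^ (-5 - 1 : ℝ) * (1 + ‖z‖) ^ (2 : ℝ)) := by
          rw [Real.rpow_one, Real.rpow_ofNat]
          ring
      _ = _ := by
          rw [← Real.rpow_add (by positivity), ← Real.rpow_add (by positivity)]
          norm_num
          ring

lemma IsDecayingProfile.add {K L : E3 → E3 →L[ℝ] E3} {C D : ℝ} (hK : IsDecayingProfile K C)
    (hL : IsDecayingProfile L D) : IsDecayingProfile (fun z => K z + L z) (C + D) where
  contDiff := hK.contDiff.add hL.contDiff
  norm_le z := by
    rw [add_mul]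
    exact (norm_add_le _ _).trans (add_le_add (hK.norm_le z) (hL.norm_le z))
  norm_fderiv_le z := by
    rw [add_mul, fderiv_fun_add (hK.contDiff.differentiable one_ne_zero z)
      (hL.contDiff.differentiable one_ne_zero z)]
    refine (ContinuousLinearMap.opNorm_add_le _ _).trans ?_
    have h1 := hK.norm_fderiv_le z
    have h2 := hL.norm_fderiv_le z
    linarith

lemma exists_isDecayingProfile_heatProfile : ∃ C, IsDecayingProfile heatProfile C := by
  obtain ⟨C, h⟩ := isDecayingCoeff_exp
  exact ⟨_, (h.const_mul (1 / Real.pi ^ ((3 : ℝ) / 2))).isDecayingProfile_id⟩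

lemma exists_isDecayingProfile_oseenProfile : ∃ C, IsDecayingProfile oseenProfile C := by
  obtain ⟨C, h⟩ := isDecayingCoeff_exp
  obtain ⟨C₁, h₁⟩ := isDecayingCoeff_gaussMoment 1
  obtain ⟨C₂, h₂⟩ := isDecayingCoeff_gaussMoment 2
  norm_num at h₁ h₂
  exact ⟨_, ((h.sub h₁).const_mul (1 / Real.pi ^ ((3 : ℝ) / 2))).isDecayingProfile_id.add
    (h₂.const_mul (2 / Real.pi ^ ((3 : ℝ) / 2))).isDecayingProfile_dyad⟩

/-! ### Scaling form of the heat and Oseen kernels. -/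

/-- The inverse length `1 / √(4νt)`. -/
def invLength (ν t : ℝ) : ℝ := 1 / Real.sqrt (4 * ν * t)

lemma invLength_nonneg (ν t : ℝ) : 0 ≤ invLength ν t := by unfold invLength; positivity

lemma invLength_sq {ν t : ℝ} (h : 0 ≤ ν * t) : invLength ν t ^ 2 = 1 / (4 * ν * t) := by
  rw [invLength, div_pow, one_pow, Real.sq_sqrt (by linarith)]

/-- The kernel with the profile `K` at the scale `l⁻¹`. -/
def dilate (K : E3 → E3 →L[ℝ] E3) (l : ℝ) (z : E3) : E3 →L[ℝ] E3 := l ^ 3 • K (l • z)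

lemma heatKernel_eq {ν t : ℝ} (h : 0 ≤ ν * t) (x : E3) :
    heatKernel ν t x =
      invLength ν t ^ 3 * (1 / Real.pi ^ ((3 : ℝ) / 2) * Real.exp (-‖invLength ν t • x‖ ^ 2)) := by
  have e : (4 * ν * t * Real.pi) ^ ((3 : ℝ) / 2)
      = Real.sqrt (4 * ν * t) ^ 3 * Real.pi ^ ((3 : ℝ) / 2) := by
    rw [Real.mul_rpow (by linarith) Real.pi_pos.le, Real.sqrt_eq_rpow, ← Real.rpow_natCast,
      ← Real.rpow_mul (by linarith)]
    norm_num
  rw [heatKernel, e, norm_smul, mul_pow, Real.norm_eq_abs, sq_abs, invLength_sq h, invLength,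
    div_pow, one_pow]
  rw [show -(1 / (4 * ν * t) * ‖x‖ ^ 2) = -‖x‖ ^ 2 / (4 * ν * t) by ring]
  field_simp

lemma heatKernel_smul_eq {ν t : ℝ} (h : 0 ≤ ν * t) (x w : E3) :
    heatKernel ν t x • w = dilate heatProfile (invLength ν t) x w := by
  rw [heatKernel_eq h, dilate, heatProfile]
  simp [smul_smul]

/-- The substitution `s = l|x|u` cancels the factor `1/|x|` and removes the singularity at the
origin, so the second derivatives can be computed everywhere by the chain rule. -/
lemma errorPotential_eq (ν t : ℝ) (x : E3) :
    errorPotential ν t x = invLength ν t * gaussMoment 0 (invLength ν t ^ 2 * ‖x‖ ^ 2) := by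
  rw [errorPotential]
  split_ifs with h
  · simp [h, gaussMoment, invLength]
  · have hx : ‖x‖ ≠ 0 := norm_ne_zero_iff.2 h
    rw [gaussMoment]
    have e : ∀ u : ℝ, u ^ (2 * 0) * Real.exp (-(invLength ν t ^ 2 * ‖x‖ ^ 2) * u ^ 2)
        = Real.exp (-((invLength ν t * ‖x‖) * u) ^ 2) := by
      intro u
      rw [mul_zero, pow_zero, one_mul]
      congr 1
      ring
    simp_rw [e]
    have := intervalIntegral.smul_integral_comp_mul_left (fun s => Real.exp (-s ^ 2)) (a := 0)
      (b := 1) (invLength ν t * ‖x‖)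
    rw [mul_zero, mul_one, smul_eq_mul] at this
    rw [show ‖x‖ / Real.sqrt (4 * ν * t) = invLength ν t * ‖x‖ by rw [invLength]; ring, ← this]
    field_simp

lemma hasFDerivAt_gaussMoment_norm_sq (k : ℕ) (l : ℝ) (z : E3) :
    HasFDerivAt (fun z : E3 => gaussMoment k (l ^ 2 * ‖z‖ ^ 2))
      ((-gaussMoment (k + 1) (l ^ 2 * ‖z‖ ^ 2) * l ^ 2) • (2 • innerSL ℝ z)) z := by
  have h : HasDerivAt (fun q => gaussMoment k (l ^ 2 * q))
      (-gaussMoment (k + 1) (l ^ 2 * ‖z‖ ^ 2) * l ^ 2) (‖z‖ ^ 2) := by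
    have h1 : HasDerivAt (fun q : ℝ => l ^ 2 * q) (l ^ 2) (‖z‖ ^ 2) := by
      simpa using (hasDerivAt_id (‖z‖ ^ 2)).const_mul (l ^ 2)
    exact (hasDerivAt_gaussMoment k _).comp _ h1
  exact hasFDerivAt_radial h

lemma inner_basisVec (z : E3) (m : Fin 3) : inner ℝ z (basisVec m) = z m := by
  simp [basisVec, EuclideanSpace.inner_single_right]

/-- Differentiating `l M₀(l²|x|²)` twice produces `M₁` on the diagonal and `M₂` with `xⱼxₘ`. The
case `t = 0` is included: division by zero gives `l = 0`, and both sides vanish, so the endpoint `s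
= t` of the Duhamel integral needs no separate treatment. -/
lemma kernelG_eq {ν t : ℝ} (h : 0 ≤ ν * t) (j m : Fin 3) (x : E3) :
    kernelG ν j m t x = invLength ν t ^ 3 *
      ((if j = m then idCoeff (‖invLength ν t • x‖ ^ 2) else 0) +
        dyadCoeff (‖invLength ν t • x‖ ^ 2) * ((invLength ν t • x) j * (invLength ν t • x) m)) := by
  set l := invLength ν t with hl
  have hn : ‖l • x‖ ^ 2 = l ^ 2 * ‖x‖ ^ 2 := by rw [norm_smul, mul_pow, Real.norm_eq_abs, sq_abs]
  have e1 : ∀ z, fderiv ℝ (errorPotential ν t) z (basisVec m)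
      = -2 * l ^ 3 * (gaussMoment 1 (l ^ 2 * ‖z‖ ^ 2) * z m) := by
    intro z
    rw [funext (errorPotential_eq ν t),
      ((hasFDerivAt_gaussMoment_norm_sq 0 l z).const_mul l).fderiv]
    simp only [smul_apply, innerSL_apply_apply, inner_basisVec, smul_eq_mul, nsmul_eq_mul]
    push_cast
    ring
  have e2 : HasFDerivAt (fun z : E3 => z m) (EuclideanSpace.proj m : E3 →L[ℝ] ℝ) x :=
    (EuclideanSpace.proj m : E3 →L[ℝ] ℝ).hasFDerivAt
  have e3 : (basisVec j) m = if j = m then 1 else 0 := by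
    simp [basisVec, eq_comm]
  have hp : ∀ z : E3, (EuclideanSpace.proj m : E3 →L[ℝ] ℝ) z = z m := fun _ => rfl
  rw [kernelG, funext e1,
    (((hasFDerivAt_gaussMoment_norm_sq 1 l x).fun_mul e2).const_mul (-2 * l ^ 3)).fderiv,
    heatKernel_eq h, ← hl, hn, idCoeff, dyadCoeff]
  simp only [smul_apply, add_apply, innerSL_apply_apply,
    inner_basisVec, smul_eq_mul, nsmul_eq_mul, hp, e3, PiLp.smul_apply]
  split_ifs <;> push_cast <;> ring

lemma applyG_eq {ν t : ℝ} (h : 0 ≤ ν * t) (x w : E3) :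
    applyG ν t x w = dilate oseenProfile (invLength ν t) x w := by
  ext j
  simp only [applyG, kernelG_eq h, dilate, oseenProfile, smul_apply,
    add_apply, dyad_apply, PiLp.smul_apply, PiLp.add_apply, smul_eq_mul,
    ContinuousLinearMap.id_apply, PiLp.inner_apply, Fin.sum_univ_three]
  fin_cases j <;> simp <;> ring

/-! ### Weights and their integrals. -/

/-- The weight `l / (1 + l|z|) = (l⁻¹ + |z|)⁻¹`. -/
def weight (l : ℝ) (z : E3) : ℝ := l / (1 + l * ‖z‖)

lemma weight_nonneg {l : ℝ} (hl : 0 ≤ l) (z : E3) : 0 ≤ weight l z := by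
  unfold weight; positivity

lemma weight_one_mul (z : E3) : weight 1 z * (1 + ‖z‖) = 1 := by
  have : 1 + ‖z‖ ≠ 0 := by positivity
  simp [weight, this]

lemma weight_one_le_one (z : E3) : weight 1 z ≤ 1 := by
  unfold weight
  exact div_le_one_of_le₀ (by linarith [norm_nonneg z]) (by positivity)

lemma weight_one_rpow (p : ℝ) (z : E3) : weight 1 z ^ p = (1 + ‖z‖) ^ (-p) := by
  rw [weight, one_mul, one_div, Real.inv_rpow (by positivity), Real.rpow_neg (by positivity)]

lemma weight_rpow {l : ℝ} (hl : 0 ≤ l) (p : ℝ) (z : E3) :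
    weight l z ^ p = l ^ p * (1 + ‖l • z‖) ^ (-p) := by
  rw [weight, norm_smul, Real.norm_of_nonneg hl, Real.div_rpow hl (by positivity),
    Real.rpow_neg (by positivity), div_eq_mul_inv]

lemma weight_mul_norm_le_one {l : ℝ} (hl : 0 ≤ l) (z : E3) : ‖z‖ * weight l z ≤ 1 := by
  unfold weight
  rw [mul_div_assoc', div_le_one (by positivity)]
  linarith

/-- The weight is comparable to itself across distances up to `l⁻¹`. This gives a dominating
function, uniform on a small ball, for differentiating convolutions. -/
lemma weight_le_two_mul {l : ℝ} (hl : 0 ≤ l) {z z' : E3} (h : l * ‖z' - z‖ ≤ 1) :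
    weight l z' ≤ 2 * weight l z := by
  unfold weight
  have h1 : l * ‖z‖ ≤ l * ‖z'‖ + l * ‖z' - z‖ := by
    rw [← mul_add]
    gcongr
    have := norm_sub_norm_le z z'
    rw [norm_sub_rev] at this
    linarith
  rw [mul_div_assoc', div_le_div_iff₀ (by positivity) (by positivity)]
  have : 0 ≤ l * ‖z'‖ := by positivity
  nlinarith

/-- The integral of `(1 + |x|)⁻ᵖ`. -/
def weightMass (p : ℝ) : ℝ := ∫ x : E3, (1 + ‖x‖) ^ (-p)

lemma weightMass_nonneg (p : ℝ) : 0 ≤ weightMass p := integral_nonneg fun x => by positivity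

lemma integrable_one_add_norm_rpow {p : ℝ} (hp : 3 < p) :
    Integrable (fun x : E3 => (1 + ‖x‖) ^ (-p)) :=
  integrable_one_add_norm (by rw [finrank_euclideanSpace_fin]; exact_mod_cast hp)

lemma integrable_weight_rpow {l : ℝ} (hl : 0 ≤ l) {p : ℝ} (hp : 3 < p) :
    Integrable (fun z => weight l z ^ p) := by
  simp_rw [weight_rpow hl]
  rcases hl.eq_or_lt with rfl | hl
  · simp [Real.zero_rpow (by linarith : p ≠ 0)]
  · exact ((integrable_one_add_norm_rpow hp).comp_smul hl.ne').const_mul _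

lemma integral_weight_rpow {l : ℝ} (hl : 0 ≤ l) {p : ℝ} (hp : 3 < p) :
    ∫ z, weight l z ^ p = l ^ (p - 3) * weightMass p := by
  simp_rw [weight_rpow hl]
  rcases hl.eq_or_lt with rfl | hl
  · simp [Real.zero_rpow (by linarith : p ≠ 0), Real.zero_rpow (by linarith : p - 3 ≠ 0)]
  · rw [integral_const_mul, Measure.integral_comp_smul volume (fun x : E3 => (1 + ‖x‖) ^ (-p)),
      finrank_euclideanSpace_fin, smul_eq_mul, abs_of_pos (by positivity), Real.rpow_sub hl,
      weightMass, ← mul_assoc, div_eq_mul_inv, Real.rpow_ofNat]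

/-- Replacing the smaller factor by the larger one turns a product of weights with two different
centres into a sum. Each term is then integrated on its own by scaling. -/
lemma rpow_mul_rpow_le {X Y p b : ℝ} (hX : 0 ≤ X) (hY : 0 ≤ Y) (hp : 0 < p) (hb : 0 < b) :
    X ^ p * Y ^ b ≤ X ^ (p + b) + Y ^ (p + b) := by
  rcases le_total X Y with h | h
  · calc X ^ p * Y ^ b ≤ Y ^ p * Y ^ b := by gcongr
      _ = Y ^ (p + b) := (Real.rpow_add_of_nonneg hY hp.le hb.le).symm
      _ ≤ _ := le_add_of_nonneg_left (by positivity)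
  · calc X ^ p * Y ^ b ≤ X ^ p * X ^ b := by gcongr
      _ = X ^ (p + b) := (Real.rpow_add_of_nonneg hX hp.le hb.le).symm
      _ ≤ _ := le_add_of_nonneg_right (by positivity)

lemma IsDecayingProfile.nonneg {K : E3 → E3 →L[ℝ] E3} {C : ℝ} (hK : IsDecayingProfile K C) :
    0 ≤ C := by
  have := (norm_nonneg _).trans (hK.norm_le 0)
  simpa using this

lemma IsDecayingProfile.norm_dilate_le {K : E3 → E3 →L[ℝ] E3} {C : ℝ}
    (hK : IsDecayingProfile K C) {l : ℝ} (hl : 0 ≤ l) (z : E3) :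
    ‖dilate K l z‖ ≤ C * weight l z ^ (3 : ℝ) := by
  rw [dilate, norm_smul, Real.norm_of_nonneg (by positivity), weight_rpow hl, Real.rpow_ofNat,
    mul_left_comm]
  exact mul_le_mul_of_nonneg_left (hK.norm_le _) (by positivity)

lemma IsDecayingProfile.contDiff_dilate {K : E3 → E3 →L[ℝ] E3} {C : ℝ}
    (hK : IsDecayingProfile K C) (l : ℝ) : ContDiff ℝ 1 (dilate K l) :=
  (contDiff_const (c := l ^ 3)).smul (hK.contDiff.comp ((contDiff_const (c := l)).smul contDiff_id))

lemma IsDecayingProfile.norm_fderiv_dilate_le {K : E3 → E3 →L[ℝ] E3} {C : ℝ}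
    (hK : IsDecayingProfile K C) {l : ℝ} (hl : 0 ≤ l) (z : E3) :
    ‖fderiv ℝ (dilate K l) z‖ ≤ C * weight l z ^ (4 : ℝ) := by
  have h1 : HasFDerivAt (fun z : E3 => l • z) (l • ContinuousLinearMap.id ℝ E3) z :=
    (hasFDerivAt_id z).const_smul l
  have h2 : HasFDerivAt (dilate K l)
      (l ^ 3 • ((fderiv ℝ K (l • z)).comp (l • ContinuousLinearMap.id ℝ E3))) z :=
    ((hK.contDiff.differentiable one_ne_zero (l • z)).hasFDerivAt.comp z h1).const_smul (l ^ 3)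
  rw [h2.fderiv, ContinuousLinearMap.comp_smul, ContinuousLinearMap.comp_id, smul_smul,
    weight_rpow hl, mul_left_comm]
  refine (ContinuousLinearMap.opNorm_smul_le _ _).trans ?_
  rw [Real.norm_of_nonneg (by positivity), ← pow_succ, Real.rpow_ofNat]
  exact mul_le_mul_of_nonneg_left (hK.norm_fderiv_le _) (by positivity)

/-! ### Convolution estimates at a fixed scale. -/

/-- The convolution of `h` with the kernel of profile `K` at the scale `l⁻¹`. -/
def smear (K : E3 → E3 →L[ℝ] E3) (l : ℝ) (h : E3 → E3) (x : E3) : E3 :=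
  ∫ y, dilate K l (x - y) (h y)

section Smear

variable {K : E3 → E3 →L[ℝ] E3} {C l A : ℝ} {h : E3 → E3}

lemma IsDecayingProfile.norm_dilate_apply_le (hK : IsDecayingProfile K C) (hl : 0 ≤ l) {p : ℝ}
    (hp : 0 < p) {w : E3} {x y : E3} (hA : ‖w‖ ≤ A * weight 1 y ^ p) :
    ‖dilate K l (x - y) w‖ ≤
      C * A * (weight l (x - y) ^ (3 + p) + weight 1 y ^ (3 + p)) := by
  have hC := hK.nonneg
  have hY := weight_nonneg zero_le_one y
  have hX := weight_nonneg hl (x - y)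
  have hAn : 0 ≤ A := nonneg_of_mul_nonneg_left ((norm_nonneg _).trans hA)
    (Real.rpow_pos_of_pos (by unfold weight; positivity) _)
  calc ‖dilate K l (x - y) w‖ ≤ ‖dilate K l (x - y)‖ * ‖w‖ := ContinuousLinearMap.le_opNorm _ _
    _ ≤ (C * weight l (x - y) ^ (3 : ℝ)) * (A * weight 1 y ^ p) := by
        gcongr
        exact hK.norm_dilate_le hl _
    _ = C * A * (weight l (x - y) ^ (3 : ℝ) * weight 1 y ^ p) := by ring
    _ ≤ _ := by
        gcongr
        exact rpow_mul_rpow_le hX hY (by norm_num) hp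

lemma integrable_weight_add (hl : 0 ≤ l) {p : ℝ} (hp : 3 < p) (x : E3) :
    Integrable (fun y => weight l (x - y) ^ p + weight 1 y ^ p) :=
  ((integrable_weight_rpow hl hp).comp_sub_left x).add (integrable_weight_rpow zero_le_one hp)

lemma integral_weight_add (hl : 0 ≤ l) {p : ℝ} (hp : 3 < p) (x : E3) :
    ∫ y, (weight l (x - y) ^ p + weight 1 y ^ p) = weightMass p * (1 + l ^ (p - 3)) := by
  rw [integral_add ((integrable_weight_rpow hl hp).comp_sub_left x)
    (integrable_weight_rpow zero_le_one hp),
    integral_sub_left_eq_self (fun z => weight l z ^ p) volume x, integral_weight_rpow hl hp,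
    integral_weight_rpow zero_le_one hp, Real.one_rpow]
  ring

lemma IsDecayingProfile.aestronglyMeasurable_dilate_apply (hK : IsDecayingProfile K C)
    (hm : AEStronglyMeasurable h volume) (x : E3) :
    AEStronglyMeasurable (fun y => dilate K l (x - y) (h y)) volume :=
  ContinuousLinearMap.aestronglyMeasurable_comp₂ (ContinuousLinearMap.id ℝ (E3 →L[ℝ] E3))
    ((hK.contDiff_dilate l).continuous.comp (continuous_sub_left x)).aestronglyMeasurable hm

lemma IsDecayingProfile.integrable_dilate_apply (hK : IsDecayingProfile K C) (hl : 0 ≤ l)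
    (hm : AEStronglyMeasurable h volume) (hA : ∀ y, ‖h y‖ ≤ A * weight 1 y) (x : E3) :
    Integrable (fun y => dilate K l (x - y) (h y)) :=
  ((integrable_weight_add hl (p := 3 + 1) (by norm_num) x).const_mul (C * A)).mono'
    (hK.aestronglyMeasurable_dilate_apply hm x)
    (ae_of_all _ fun y => hK.norm_dilate_apply_le hl one_pos (by simpa using hA y))

lemma IsDecayingProfile.integral_norm_dilate_apply_le (hK : IsDecayingProfile K C) (hl : 0 ≤ l)
    (hA : ∀ y, ‖h y‖ ≤ A * weight 1 y) (x : E3) :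
    ∫ y, ‖dilate K l (x - y) (h y)‖ ≤ C * A * weightMass 4 * (1 + l) := by
  refine (Real.le_norm_self _).trans ((norm_integral_le_of_norm_le
    ((integrable_weight_add hl (p := 3 + 1) (by norm_num) x).const_mul (C * A))
    (ae_of_all _ fun y => ?_)).trans ?_)
  · rw [norm_norm]
    exact hK.norm_dilate_apply_le hl one_pos (by simpa using hA y)
  · rw [integral_const_mul, integral_weight_add hl (by norm_num)]
    norm_num [mul_assoc]

/-- The kernel supplies three powers of its weight and the density one. The resulting fourth powers
are integrable, with integrals proportional to `l` and `1`. -/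
lemma IsDecayingProfile.norm_smear_le (hK : IsDecayingProfile K C) (hl : 0 ≤ l)
    (hA : ∀ y, ‖h y‖ ≤ A * weight 1 y) (x : E3) :
    ‖smear K l h x‖ ≤ C * A * weightMass 4 * (1 + l) :=
  (norm_integral_le_integral_norm _).trans (hK.integral_norm_dilate_apply_le hl hA x)

lemma IsDecayingProfile.hasFDerivAt_dilate_apply (hK : IsDecayingProfile K C) (x y w : E3) :
    HasFDerivAt (fun x => dilate K l (x - y) w) ((fderiv ℝ (dilate K l) (x - y)).flip w) x := by
  have h1 : HasFDerivAt (fun x => dilate K l (x - y)) (fderiv ℝ (dilate K l) (x - y)) x := by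
    have := ((hK.contDiff_dilate l).differentiable one_ne_zero (x - y)).hasFDerivAt.comp x
      ((hasFDerivAt_id x).sub_const y)
    rwa [ContinuousLinearMap.comp_id] at this
  have := h1.clm_apply (hasFDerivAt_const w x)
  simpa using this

lemma IsDecayingProfile.norm_flip_fderiv_dilate_le (hK : IsDecayingProfile K C) (hl : 0 ≤ l)
    {w : E3} (hA : ‖w‖ ≤ A) (z : E3) :
    ‖(fderiv ℝ (dilate K l) z).flip w‖ ≤ C * A * weight l z ^ (4 : ℝ) := by
  have h1 := hK.norm_fderiv_dilate_le hl z
  calc _ ≤ ‖(fderiv ℝ (dilate K l) z).flip‖ * ‖w‖ := ContinuousLinearMap.le_opNorm _ _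
    _ ≤ (C * weight l z ^ (4 : ℝ)) * A := by
        rw [ContinuousLinearMap.opNorm_flip]
        exact mul_le_mul h1 hA (norm_nonneg _) ((norm_nonneg (fderiv ℝ (dilate K l) z)).trans h1)
    _ = _ := by ring

lemma IsDecayingProfile.norm_flip_fderiv_dilate_le_of_mem_ball (hK : IsDecayingProfile K C)
    (hl : 0 ≤ l) {w : E3} (hA : ‖w‖ ≤ A) {x₀ x : E3} (hx : x ∈ Metric.ball x₀ (1 / (1 + l)))
    (y : E3) :
    ‖(fderiv ℝ (dilate K l) (x - y)).flip w‖ ≤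
      C * A * 2 ^ (4 : ℝ) * weight l (x₀ - y) ^ (4 : ℝ) := by
  refine (hK.norm_flip_fderiv_dilate_le hl hA (x - y)).trans ?_
  have h1 : weight l (x - y) ≤ 2 * weight l (x₀ - y) := by
    -- The radius `1/(1+l)` forces `l|x-x₀| ≤ 1`, and stays positive and finite when `l = 0`.
    refine weight_le_two_mul hl ?_
    rw [sub_sub_sub_cancel_right]
    rw [mem_ball_iff_norm, lt_div_iff₀ (by positivity)] at hx
    nlinarith [norm_nonneg (x - x₀)]
  rw [mul_assoc (C * A), ← Real.mul_rpow (by norm_num) (weight_nonneg hl _)]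
  have h2 := weight_nonneg hl (x - y)
  have h3 : 0 ≤ C * A := mul_nonneg hK.nonneg ((norm_nonneg _).trans hA)
  gcongr

lemma IsDecayingProfile.continuous_flip_fderiv_dilate (hK : IsDecayingProfile K C) :
    Continuous fun p : E3 × E3 => (fderiv ℝ (dilate K l) p.1).flip p.2 :=
  ((ContinuousLinearMap.flipₗᵢ ℝ E3 E3 E3).continuous.comp
    (((hK.contDiff_dilate l).continuous_fderiv one_ne_zero).comp continuous_fst)).clm_apply
      continuous_snd

lemma IsDecayingProfile.aestronglyMeasurable_flip_fderiv (hK : IsDecayingProfile K C)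
    (hm : AEStronglyMeasurable h volume) (x : E3) :
    AEStronglyMeasurable (fun y => (fderiv ℝ (dilate K l) (x - y)).flip (h y)) volume := by
  have h1 : AEStronglyMeasurable (fun y => (x - y, h y)) volume :=
    (continuous_sub_left x).aestronglyMeasurable.prodMk hm
  have h2 := (hK.continuous_flip_fderiv_dilate (l := l)).comp_aestronglyMeasurable h1
  exact h2

lemma IsDecayingProfile.hasFDerivAt_smear (hK : IsDecayingProfile K C) (hl : 0 ≤ l)
    (hm : AEStronglyMeasurable h volume) (hA : ∀ y, ‖h y‖ ≤ A * weight 1 y) (hA0 : 0 ≤ A)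
    (x : E3) :
    HasFDerivAt (smear K l h) (∫ y, (fderiv ℝ (dilate K l) (x - y)).flip (h y)) x := by
  have hA' : ∀ y, ‖h y‖ ≤ A := fun y =>
    (hA y).trans (mul_le_of_le_one_right hA0 (weight_one_le_one y))
  exact hasFDerivAt_integral_of_dominated_of_fderiv_le
    (F' := fun x y => (fderiv ℝ (dilate K l) (x - y)).flip (h y))
    (bound := fun y => C * A * 2 ^ (4 : ℝ) * weight l (x - y) ^ (4 : ℝ))
    (Metric.ball_mem_nhds x (by positivity : 0 < 1 / (1 + l)))
    (Eventually.of_forall fun x => hK.aestronglyMeasurable_dilate_apply hm x)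
    (hK.integrable_dilate_apply hl hm hA x)
    (hK.aestronglyMeasurable_flip_fderiv hm x)
    (ae_of_all _ fun y x' hx' => hK.norm_flip_fderiv_dilate_le_of_mem_ball hl (hA' y) hx' y)
    (((integrable_weight_rpow hl (by norm_num)).comp_sub_left x).const_mul _)
    (ae_of_all _ fun y x' _ => hK.hasFDerivAt_dilate_apply x' y (h y))

lemma IsDecayingProfile.contDiff_smear (hK : IsDecayingProfile K C) (hl : 0 ≤ l)
    (hm : AEStronglyMeasurable h volume) (hA : ∀ y, ‖h y‖ ≤ A * weight 1 y) (hA0 : 0 ≤ A) :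
    ContDiff ℝ 1 (smear K l h) := by
  have hA' : ∀ y, ‖h y‖ ≤ A := fun y =>
    (hA y).trans (mul_le_of_le_one_right hA0 (weight_one_le_one y))
  rw [contDiff_one_iff_fderiv]
  refine ⟨fun x => (hK.hasFDerivAt_smear hl hm hA hA0 x).differentiableAt, ?_⟩
  rw [funext fun x => (hK.hasFDerivAt_smear hl hm hA hA0 x).fderiv, continuous_iff_continuousAt]
  refine fun x => continuousAt_of_dominated
    (bound := fun y => C * A * 2 ^ (4 : ℝ) * weight l (x - y) ^ (4 : ℝ))
    (Eventually.of_forall fun x => hK.aestronglyMeasurable_flip_fderiv hm x) ?_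
    (((integrable_weight_rpow hl (by norm_num)).comp_sub_left x).const_mul _)
    (ae_of_all _ fun y => ?_)
  · filter_upwards [Metric.ball_mem_nhds x (by positivity : 0 < 1 / (1 + l))] with x' hx'
    exact ae_of_all _ fun y => hK.norm_flip_fderiv_dilate_le_of_mem_ball hl (hA' y) hx' y
  · exact (hK.continuous_flip_fderiv_dilate.comp
      ((continuous_sub_right y).prodMk continuous_const)).continuousAt

lemma IsDecayingProfile.norm_fderiv_smear_le (hK : IsDecayingProfile K C) (hl : 0 ≤ l)
    (hm : AEStronglyMeasurable h volume) (hA : ∀ y, ‖h y‖ ≤ A * weight 1 y) (hA0 : 0 ≤ A)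
    (x : E3) : ‖fderiv ℝ (smear K l h) x‖ ≤ C * A * weightMass 4 * l := by
  have hA' : ∀ y, ‖h y‖ ≤ A := fun y =>
    (hA y).trans (mul_le_of_le_one_right hA0 (weight_one_le_one y))
  rw [(hK.hasFDerivAt_smear hl hm hA hA0 x).fderiv]
  refine (norm_integral_le_of_norm_le
    (((integrable_weight_rpow hl (by norm_num)).comp_sub_left x).const_mul (C * A))
    (ae_of_all _ fun y => hK.norm_flip_fderiv_dilate_le hl (hA' y) (x - y))).trans (le_of_eq ?_)
  rw [integral_const_mul, integral_sub_left_eq_self (fun z => weight l z ^ (4 : ℝ)) volume x,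
    integral_weight_rpow hl (by norm_num)]
  norm_num
  ring

/-- Since `1+|x| ≤ (1+|y|) + |x-y|`, the growth in `x` is absorbed either by the weight of the
density, leaving exponents `3` and `1/4`, or by that of the kernel, leaving `5/4` and `2`. Both
pairs total `13/4 > 3`, hence are integrable; the full order 2 in place of `7/4` would leave exactly
3. -/
lemma one_add_norm_rpow_mul_weight_le (hl : 0 ≤ l) (x y : E3) :
    (1 + ‖x‖) ^ (7 / 4 : ℝ) * (weight l (x - y) ^ (3 : ℝ) * weight 1 y ^ (2 : ℝ)) ≤
      2 * 2 ^ (7 / 4 : ℝ) * (weight l (x - y) ^ (13 / 4 : ℝ) + weight 1 y ^ (13 / 4 : ℝ)) := by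
  set X := weight l (x - y)
  set Y := weight 1 y with hY
  have hX0 : 0 ≤ X := weight_nonneg hl _
  have hY0 : 0 ≤ Y := weight_nonneg zero_le_one _
  have h1 : (1 + ‖x‖) ^ (7 / 4 : ℝ) ≤
      2 ^ (7 / 4 : ℝ) * ((1 + ‖y‖) ^ (7 / 4 : ℝ) + ‖x - y‖ ^ (7 / 4 : ℝ)) := by
    have hx : ‖x‖ ≤ ‖x - y‖ + ‖y‖ := by simpa using norm_add_le (x - y) y
    rcases le_total (1 + ‖y‖) ‖x - y‖ with h | h
    · calc (1 + ‖x‖) ^ (7 / 4 : ℝ) ≤ (2 * ‖x - y‖) ^ (7 / 4 : ℝ) := by gcongr; linarith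
        _ = 2 ^ (7 / 4 : ℝ) * ‖x - y‖ ^ (7 / 4 : ℝ) := Real.mul_rpow (by norm_num) (by positivity)
        _ ≤ _ := by gcongr; exact le_add_of_nonneg_left (by positivity)
    · calc (1 + ‖x‖) ^ (7 / 4 : ℝ) ≤ (2 * (1 + ‖y‖)) ^ (7 / 4 : ℝ) := by gcongr; linarith
        _ = 2 ^ (7 / 4 : ℝ) * (1 + ‖y‖) ^ (7 / 4 : ℝ) :=
          Real.mul_rpow (by norm_num) (by positivity)
        _ ≤ _ := by gcongr; exact le_add_of_nonneg_right (by positivity)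
  have h2 : (1 + ‖y‖) ^ (7 / 4 : ℝ) * Y ^ (2 : ℝ) = Y ^ (1 / 4 : ℝ) := by
    rw [show (2 : ℝ) = 7 / 4 + 1 / 4 by norm_num,
      Real.rpow_add_of_nonneg hY0 (by norm_num) (by norm_num), ← mul_assoc,
      ← Real.mul_rpow (by positivity) hY0, mul_comm (1 + ‖y‖), hY, weight_one_mul, Real.one_rpow,
      one_mul]
  have h3 : ‖x - y‖ ^ (7 / 4 : ℝ) * X ^ (3 : ℝ) ≤ X ^ (5 / 4 : ℝ) := by
    rw [show (3 : ℝ) = 7 / 4 + 5 / 4 by norm_num,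
      Real.rpow_add_of_nonneg hX0 (by norm_num) (by norm_num), ← mul_assoc,
      ← Real.mul_rpow (by positivity) hX0]
    refine mul_le_of_le_one_left (by positivity) (Real.rpow_le_one (by positivity)
      (weight_mul_norm_le_one hl _) (by norm_num))
  have h4 := rpow_mul_rpow_le hX0 hY0 (p := 3) (b := 1 / 4) (by norm_num) (by norm_num)
  have h5 := rpow_mul_rpow_le hX0 hY0 (p := 5 / 4) (b := 2) (by norm_num) (by norm_num)
  rw [show (3 + 1 / 4 : ℝ) = 13 / 4 by norm_num] at h4
  rw [show (5 / 4 + 2 : ℝ) = 13 / 4 by norm_num] at h5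
  calc (1 + ‖x‖) ^ (7 / 4 : ℝ) * (X ^ (3 : ℝ) * Y ^ (2 : ℝ))
      ≤ 2 ^ (7 / 4 : ℝ) * ((1 + ‖y‖) ^ (7 / 4 : ℝ) + ‖x - y‖ ^ (7 / 4 : ℝ)) *
        (X ^ (3 : ℝ) * Y ^ (2 : ℝ)) := by gcongr
    _ = 2 ^ (7 / 4 : ℝ) * (X ^ (3 : ℝ) * ((1 + ‖y‖) ^ (7 / 4 : ℝ) * Y ^ (2 : ℝ)) +
        ‖x - y‖ ^ (7 / 4 : ℝ) * X ^ (3 : ℝ) * Y ^ (2 : ℝ)) := by ring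
    _ ≤ 2 ^ (7 / 4 : ℝ) * (X ^ (3 : ℝ) * Y ^ (1 / 4 : ℝ) + X ^ (5 / 4 : ℝ) * Y ^ (2 : ℝ)) := by
        rw [h2]
        gcongr
    _ ≤ 2 ^ (7 / 4 : ℝ) * ((X ^ (13 / 4 : ℝ) + Y ^ (13 / 4 : ℝ)) +
        (X ^ (13 / 4 : ℝ) + Y ^ (13 / 4 : ℝ))) := by gcongr
    _ = _ := by ring

lemma IsDecayingProfile.norm_smear_le_rpow (hK : IsDecayingProfile K C) (hl : 0 ≤ l)
    (hA : ∀ y, ‖h y‖ ≤ A * weight 1 y ^ (2 : ℝ)) (hA0 : 0 ≤ A) (x : E3) :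
    ‖smear K l h x‖ ≤ C * A * (2 * 2 ^ (7 / 4 : ℝ)) * weightMass (13 / 4) * (1 + l ^ (1 / 4 : ℝ)) *
      (1 + ‖x‖) ^ (-(7 / 4) : ℝ) := by
  have hC := hK.nonneg
  rw [Real.rpow_neg (by positivity), ← div_eq_mul_inv, le_div_iff₀ (by positivity)]
  have hi := integrable_weight_add hl (p := 13 / 4) (by norm_num) x
  have hb : ∀ y, ‖dilate K l (x - y) (h y)‖ ≤
      (C * A * (2 * 2 ^ (7 / 4 : ℝ)) / (1 + ‖x‖) ^ (7 / 4 : ℝ)) *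
        (weight l (x - y) ^ (13 / 4 : ℝ) + weight 1 y ^ (13 / 4 : ℝ)) := by
    intro y
    rw [div_mul_eq_mul_div, le_div_iff₀ (by positivity)]
    have hX := weight_nonneg hl (x - y)
    have hY := weight_nonneg zero_le_one y
    calc ‖dilate K l (x - y) (h y)‖ * (1 + ‖x‖) ^ (7 / 4 : ℝ)
        ≤ (C * weight l (x - y) ^ (3 : ℝ)) * (A * weight 1 y ^ (2 : ℝ)) *
          (1 + ‖x‖) ^ (7 / 4 : ℝ) := by
          refine mul_le_mul_of_nonneg_right ((ContinuousLinearMap.le_opNorm _ _).trans ?_)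
            (by positivity)
          exact mul_le_mul (hK.norm_dilate_le hl _) (hA y) (norm_nonneg _) (by positivity)
      _ = C * A * ((1 + ‖x‖) ^ (7 / 4 : ℝ) *
          (weight l (x - y) ^ (3 : ℝ) * weight 1 y ^ (2 : ℝ))) := by ring
      _ ≤ C * A * (2 * 2 ^ (7 / 4 : ℝ) *
          (weight l (x - y) ^ (13 / 4 : ℝ) + weight 1 y ^ (13 / 4 : ℝ))) := by
          exact mul_le_mul_of_nonneg_left (one_add_norm_rpow_mul_weight_le hl x y) (by positivity)
      _ = _ := by ring
  have := norm_integral_le_of_norm_le (hi.const_mul _) (ae_of_all _ hb)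
  rw [integral_const_mul, integral_weight_add hl (by norm_num), div_mul_eq_mul_div,
    le_div_iff₀ (by positivity)] at this
  norm_num at this ⊢
  rw [mul_assoc _ (weightMass _)]
  exact this

end Smear

/-! ### The singular factor in time and exponential weights. -/

section TimeWeights

variable {ν : ℝ}

lemma invLength_eq_rpow (hν : 0 < ν) {t : ℝ} (ht : 0 ≤ t) :
    invLength ν t = invLength ν 1 * t ^ (-(1 / 2) : ℝ) := by
  rw [invLength, invLength, Real.sqrt_mul (by positivity), mul_one, Real.rpow_neg ht,
    ← Real.sqrt_eq_rpow]
  ring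

lemma measurable_invLength (ν : ℝ) : Measurable (invLength ν) := by
  unfold invLength
  fun_prop

lemma intervalIntegrable_invLength (hν : 0 < ν) {t : ℝ} (ht : 0 ≤ t) :
    IntervalIntegrable (invLength ν) volume 0 t := by
  refine ((intervalIntegral.intervalIntegrable_rpow' (r := -(1 / 2))
    (by norm_num)).const_mul (invLength ν 1)).congr fun s hs => ?_
  rw [uIoc_of_le ht] at hs
  exact (invLength_eq_rpow hν hs.1.le).symm

lemma intervalIntegrable_invLength_sub (hν : 0 < ν) {t : ℝ} (ht : 0 ≤ t) :
    IntervalIntegrable (fun s => invLength ν (t - s)) volume 0 t := by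
  have := (intervalIntegrable_invLength hν ht).comp_sub_left t
  simpa using this.symm

lemma intervalIntegrable_one_add_invLength_mul_exp (hν : 0 < ν) {t : ℝ} (ht : 0 ≤ t) (μ : ℝ) :
    IntervalIntegrable (fun s => (1 + invLength ν (t - s)) * Real.exp (μ * s)) volume 0 t :=
  ((intervalIntegrable_const (c := (1 : ℝ))).add
    (intervalIntegrable_invLength_sub hν ht)).mul_continuousOn
    (Continuous.continuousOn (by fun_prop))

lemma integral_rpow_exp_bound {a r t : ℝ} (ha : 0 < a) (hr : 0 < r) (ht : 0 ≤ t) :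
    IntervalIntegrable (fun s => s ^ (a - 1) * Real.exp (-(r * s))) volume 0 t ∧
    ∫ s in (0 : ℝ)..t, s ^ (a - 1) * Real.exp (-(r * s)) ≤ (1 / r) ^ a * Real.Gamma a := by
  have key := Real.integral_rpow_mul_exp_neg_mul_Ioi ha hr
  have hG := Real.Gamma_pos_of_pos ha
  have hint : IntegrableOn (fun x : ℝ => x ^ (a - 1) * Real.exp (-(r * x))) (Ioi 0) :=
    Integrable.of_integral_ne_zero (by rw [key]; positivity)
  refine ⟨(intervalIntegrable_iff_integrableOn_Ioc_of_le ht).2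
    (hint.mono_set Ioc_subset_Ioi_self), ?_⟩
  rw [← key, intervalIntegral.integral_of_le ht]
  refine setIntegral_mono_set hint ?_ Ioc_subset_Ioi_self.eventuallyLE
  filter_upwards [ae_restrict_mem measurableSet_Ioi] with u hu
  have : (0 : ℝ) < u := hu
  positivity

/-- An exponential weight in time makes the integrals of the singular factor small. -/
lemma exists_exp_rate (hν : 0 < ν) {ε : ℝ} (hε : 0 < ε) :
    ∃ μ : ℝ, 0 < μ ∧ ∀ t : ℝ, 0 ≤ t →
      ∫ s in (0 : ℝ)..t, (1 + invLength ν (t - s)) * Real.exp (μ * s) ≤ ε * Real.exp (μ * t) := by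
  -- After the reflection `s ↦ t - s` and removal of `exp(μt)`, the integral is at most the Laplace
  -- transform of `1 + c s^(-1/2)` at `μ`. This is the Gamma expression here, which tends to zero.
  have hlim : Tendsto (fun r : ℝ => (1 / r) ^ (1 : ℝ) * Real.Gamma 1 +
      invLength ν 1 * ((1 / r) ^ (1 / 2 : ℝ) * Real.Gamma (1 / 2))) atTop (𝓝 0) := by
    have h0 : Tendsto (fun r : ℝ => 1 / r) atTop (𝓝 0) := by
      simpa using tendsto_inv_atTop_zero (𝕜 := ℝ)
    have h1 := (h0.rpow_const (p := 1) (Or.inr zero_le_one)).mul_const (Real.Gamma 1)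
    have h2 := ((h0.rpow_const (p := 1 / 2) (Or.inr (by norm_num))).mul_const
      (Real.Gamma (1 / 2))).const_mul (invLength ν 1)
    simpa using h1.add h2
  obtain ⟨μ, hμ, hμ0⟩ := ((hlim.eventually (gt_mem_nhds hε)).and (eventually_gt_atTop 0)).exists
  refine ⟨μ, hμ0, fun t ht => ?_⟩
  have h1 := integral_rpow_exp_bound one_pos hμ0 ht
  have h2 := integral_rpow_exp_bound (show (0 : ℝ) < 1 / 2 by norm_num) hμ0 ht
  have e : ∫ s in (0 : ℝ)..t, (1 + invLength ν (t - s)) * Real.exp (μ * s) =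
      ∫ s in (0 : ℝ)..t, Real.exp (μ * t) * (s ^ ((1 : ℝ) - 1) * Real.exp (-(μ * s)) +
        invLength ν 1 * (s ^ ((1 / 2 : ℝ) - 1) * Real.exp (-(μ * s)))) := by
    have := intervalIntegral.integral_comp_sub_left (a := 0) (b := t)
      (fun s => (1 + invLength ν s) * Real.exp (μ * (t - s))) t
    simp only [sub_sub_cancel, sub_self, sub_zero] at this
    rw [this]
    refine intervalIntegral.integral_congr fun s hs => ?_
    rw [uIcc_of_le ht] at hs
    have h3 : Real.exp (μ * (t - s)) = Real.exp (μ * t) * Real.exp (-(μ * s)) := by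
      rw [← Real.exp_add]; ring_nf
    rw [invLength_eq_rpow hν hs.1, h3, sub_self, Real.rpow_zero]
    norm_num
    ring
  rw [e, intervalIntegral.integral_const_mul, mul_comm,
    intervalIntegral.integral_add h1.1 (h2.1.const_mul _), intervalIntegral.integral_const_mul]
  refine mul_le_mul_of_nonneg_right ?_ (Real.exp_pos _).le
  have := mul_le_mul_of_nonneg_left h2.2 (invLength_nonneg ν 1)
  linarith [h1.2]

end TimeWeights

/-! ### Regularity and size of the Duhamel integral. -/

lemma clm_eq_sum (L : E3 →L[ℝ] E3) :
    L = ∑ j : Fin 3, (EuclideanSpace.proj j : E3 →L[ℝ] ℝ).smulRight (L (basisVec j)) := by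
  ext x : 1
  have hx : x = ∑ j : Fin 3, x j • basisVec j := by
    have := (EuclideanSpace.basisFun (Fin 3) ℝ).sum_repr x
    simpa [basisVec] using this.symm
  conv_lhs => rw [hx, map_sum]
  simp

/-- Each directional derivative is a limit of measurable difference quotients, and finitely many
directions determine the operator. Measurability in the parameter is thus needed only pointwise in
`x`. -/
lemma aestronglyMeasurable_fderiv_of_forall {α : Type*} [MeasurableSpace α] {μ : Measure α}
    {F : α → E3 → E3} {x : E3} (hF : ∀ x, AEStronglyMeasurable (fun a => F a x) μ)
    (hd : ∀ᵐ a ∂μ, DifferentiableAt ℝ (F a) x) :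
    AEStronglyMeasurable (fun a => fderiv ℝ (F a) x) μ := by
  have h1 : ∀ e : E3, AEStronglyMeasurable (fun a => fderiv ℝ (F a) x e) μ := fun e =>
    aestronglyMeasurable_of_tendsto_ae atTop
      (f := fun (c : ℝ) a => c • (F a (x + c⁻¹ • e) - F a x))
      (fun c => ((hF _).sub (hF _)).const_smul c)
      (hd.mono fun a ha => ha.hasFDerivAt.lim_real e)
  have h2 : (fun a => fderiv ℝ (F a) x) = fun a => ∑ j : Fin 3,
      (EuclideanSpace.proj j : E3 →L[ℝ] ℝ).smulRight (fderiv ℝ (F a) x (basisVec j)) :=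
    funext fun a => clm_eq_sum _
  rw [h2]
  refine Finset.aestronglyMeasurable_fun_sum _ fun j _ => ?_
  exact (ContinuousLinearMap.smulRightL ℝ E3 E3 (EuclideanSpace.proj j)).continuous
    |>.comp_aestronglyMeasurable (h1 (basisVec j))

/-- The density `h` has a Duhamel integral up to the time `t`: it is measurable, and bounded by
`A exp (μ s) / (1 + |y|)`. -/
structure IsAdmissible (ν t A μ : ℝ) (h : ℝ → E3 → E3) : Prop where
  nonneg : 0 ≤ A
  kernel_meas : ∀ x, AEStronglyMeasurable
    (fun p : ℝ × E3 => applyG ν (t - p.1) (x - p.2) (h p.1 p.2))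
    ((volume.restrict (Ioc 0 t)).prod volume)
  slice_meas : ∀ s ∈ Ioc 0 t, AEStronglyMeasurable (h s) volume
  bound : ∀ s ∈ Ioc 0 t, ∀ y, ‖h s y‖ ≤ A * Real.exp (μ * s) * weight 1 y

lemma integral_applyG_eq {ν t s : ℝ} (hν : 0 < ν) (hs : s ≤ t) (h : ℝ → E3 → E3) (x : E3) :
    ∫ y, applyG ν (t - s) (x - y) (h s y) =
      smear oseenProfile (invLength ν (t - s)) (h s) x := by
  have : 0 ≤ ν * (t - s) := mul_nonneg hν.le (sub_nonneg.2 hs)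
  simp_rw [applyG_eq this]
  rfl

lemma duhamel_eq {ν t : ℝ} (hν : 0 < ν) (ht : 0 ≤ t) (h : ℝ → E3 → E3) (x : E3) :
    duhamel ν h t x =
      ∫ s in Ioc 0 t, smear oseenProfile (invLength ν (t - s)) (h s) x := by
  rw [duhamel, intervalIntegral.integral_of_le ht]
  exact setIntegral_congr_fun measurableSet_Ioc fun s hs => integral_applyG_eq hν hs.2 h x

namespace IsAdmissible

variable {ν t A μ C : ℝ} {h : ℝ → E3 → E3}

lemma mul_exp_nonneg (H : IsAdmissible ν t A μ h) (s : ℝ) : 0 ≤ A * Real.exp (μ * s) :=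
  mul_nonneg H.nonneg (Real.exp_pos _).le

lemma integrableOn_bound (_ : IsAdmissible ν t A μ h) (hν : 0 < ν) (ht : 0 ≤ t)
    (C : ℝ) : IntegrableOn (fun s => C * (A * Real.exp (μ * s)) * weightMass 4 *
      (1 + invLength ν (t - s))) (Ioc 0 t) := by
  have h1 := (intervalIntegrable_one_add_invLength_mul_exp hν ht μ).const_mul
    (C * A * weightMass 4)
  rw [intervalIntegrable_iff_integrableOn_Ioc_of_le ht] at h1
  refine h1.congr_fun (fun s _ => ?_) measurableSet_Ioc
  simp only
  ring

/-- Tonelli: the spatial integral of the norm is at most a multiple of `1 + l(t-s)`, which is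
integrable in time. -/
lemma duhamelConverges (H : IsAdmissible ν t A μ h) (hν : 0 < ν) (ht : 0 ≤ t) (x : E3) :
    DuhamelConverges ν h t x := by
  obtain ⟨C, hK⟩ := exists_isDecayingProfile_oseenProfile
  rw [DuhamelConverges, integrable_prod_iff (H.kernel_meas x)]
  constructor
  · filter_upwards [ae_restrict_mem measurableSet_Ioc] with s hs
    simp_rw [applyG_eq (mul_nonneg hν.le (sub_nonneg.2 hs.2))]
    exact hK.integrable_dilate_apply (invLength_nonneg _ _) (H.slice_meas s hs) (H.bound s hs) x
  · refine (H.integrableOn_bound hν ht C).mono' (H.kernel_meas x).norm.integral_prod_right' ?_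
    filter_upwards [ae_restrict_mem measurableSet_Ioc] with s hs
    rw [Real.norm_of_nonneg (integral_nonneg fun _ => norm_nonneg _)]
    simp_rw [applyG_eq (mul_nonneg hν.le (sub_nonneg.2 hs.2))]
    exact hK.integral_norm_dilate_apply_le (invLength_nonneg _ _) (H.bound s hs) x

lemma norm_duhamel_le (H : IsAdmissible ν t A μ h) (hK : IsDecayingProfile oseenProfile C)
    (hν : 0 < ν) (ht : 0 ≤ t) (x : E3) :
    ‖duhamel ν h t x‖ ≤ ∫ s in Ioc 0 t, C * (A * Real.exp (μ * s)) * weightMass 4 *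
      (1 + invLength ν (t - s)) := by
  rw [duhamel_eq hν ht]
  refine norm_integral_le_of_norm_le (H.integrableOn_bound hν ht C) ?_
  filter_upwards [ae_restrict_mem measurableSet_Ioc] with s hs
  exact hK.norm_smear_le (invLength_nonneg _ _) (H.bound s hs) x

lemma norm_fderiv_smear_le (H : IsAdmissible ν t A μ h) (hK : IsDecayingProfile oseenProfile C)
    {s : ℝ} (hs : s ∈ Ioc 0 t) (x : E3) :
    ‖fderiv ℝ (smear oseenProfile (invLength ν (t - s)) (h s)) x‖ ≤
      C * (A * Real.exp (μ * s)) * weightMass 4 * (1 + invLength ν (t - s)) := by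
  refine (hK.norm_fderiv_smear_le (invLength_nonneg _ _) (H.slice_meas s hs) (H.bound s hs)
    (H.mul_exp_nonneg s) x).trans ?_
  have := mul_nonneg (mul_nonneg hK.nonneg (H.mul_exp_nonneg s)) (weightMass_nonneg 4)
  gcongr
  linarith

lemma contDiff_smear (H : IsAdmissible ν t A μ h) {s : ℝ} (hs : s ∈ Ioc 0 t) :
    ContDiff ℝ 1 (smear oseenProfile (invLength ν (t - s)) (h s)) := by
  obtain ⟨C, hK⟩ := exists_isDecayingProfile_oseenProfile
  exact hK.contDiff_smear (invLength_nonneg _ _) (H.slice_meas s hs) (H.bound s hs)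
    (H.mul_exp_nonneg s)

lemma aestronglyMeasurable_smear (H : IsAdmissible ν t A μ h) (hν : 0 < ν) (x : E3) :
    AEStronglyMeasurable (fun s => smear oseenProfile (invLength ν (t - s)) (h s) x)
      (volume.restrict (Ioc 0 t)) := by
  refine (H.kernel_meas x).integral_prod_right'.congr ?_
  filter_upwards [ae_restrict_mem measurableSet_Ioc] with s hs
  exact integral_applyG_eq hν hs.2 h x

lemma aestronglyMeasurable_fderiv_smear (H : IsAdmissible ν t A μ h) (hν : 0 < ν) (x : E3) :
    AEStronglyMeasurable
      (fun s => fderiv ℝ (smear oseenProfile (invLength ν (t - s)) (h s)) x)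
      (volume.restrict (Ioc 0 t)) := by
  refine aestronglyMeasurable_fderiv_of_forall (H.aestronglyMeasurable_smear hν) ?_
  filter_upwards [ae_restrict_mem measurableSet_Ioc] with s hs
  exact (H.contDiff_smear hs).differentiable one_ne_zero x

/-- The gradient at lag `t-s` is `O(1 + l(t-s))` uniformly in `x`, so one integrable function
dominates on the whole space. -/
lemma hasFDerivAt_duhamel (H : IsAdmissible ν t A μ h) (hν : 0 < ν) (ht : 0 ≤ t) (x : E3) :
    HasFDerivAt (duhamel ν h t) (∫ s in Ioc 0 t,
      fderiv ℝ (smear oseenProfile (invLength ν (t - s)) (h s)) x) x := by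
  obtain ⟨C, hK⟩ := exists_isDecayingProfile_oseenProfile
  rw [funext (duhamel_eq hν ht h)]
  refine hasFDerivAt_integral_of_dominated_of_fderiv_le
    (F' := fun x s => fderiv ℝ (smear oseenProfile (invLength ν (t - s)) (h s)) x)
    (Filter.univ_mem) (Eventually.of_forall fun x => H.aestronglyMeasurable_smear hν x)
    ((H.integrableOn_bound hν ht C).mono' (H.aestronglyMeasurable_smear hν x) ?_)
    (H.aestronglyMeasurable_fderiv_smear hν x) ?_ (H.integrableOn_bound hν ht C) ?_
  all_goals filter_upwards [ae_restrict_mem measurableSet_Ioc] with s hs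
  · exact hK.norm_smear_le (invLength_nonneg _ _) (H.bound s hs) x
  · exact fun x _ => H.norm_fderiv_smear_le hK hs x
  · exact fun x _ => ((H.contDiff_smear hs).differentiable one_ne_zero x).hasFDerivAt

lemma contDiff_duhamel (H : IsAdmissible ν t A μ h) (hν : 0 < ν) (ht : 0 ≤ t) :
    ContDiff ℝ 1 (duhamel ν h t) := by
  obtain ⟨C, hK⟩ := exists_isDecayingProfile_oseenProfile
  rw [contDiff_one_iff_fderiv]
  refine ⟨fun x => (H.hasFDerivAt_duhamel hν ht x).differentiableAt, ?_⟩
  rw [funext fun x => (H.hasFDerivAt_duhamel hν ht x).fderiv]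
  refine continuous_of_dominated (fun x => H.aestronglyMeasurable_fderiv_smear hν x)
    (fun x => ?_) (H.integrableOn_bound hν ht C) ?_
  all_goals filter_upwards [ae_restrict_mem measurableSet_Ioc] with s hs
  · exact H.norm_fderiv_smear_le hK hs x
  · exact (H.contDiff_smear hs).continuous_fderiv one_ne_zero

lemma norm_fderiv_duhamel_le (H : IsAdmissible ν t A μ h)
    (hK : IsDecayingProfile oseenProfile C) (hν : 0 < ν) (ht : 0 ≤ t) (x : E3) :
    ‖fderiv ℝ (duhamel ν h t) x‖ ≤ ∫ s in Ioc 0 t, C * (A * Real.exp (μ * s)) * weightMass 4 *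
      (1 + invLength ν (t - s)) := by
  rw [(H.hasFDerivAt_duhamel hν ht x).fderiv]
  refine norm_integral_le_of_norm_le (H.integrableOn_bound hν ht C) ?_
  filter_upwards [ae_restrict_mem measurableSet_Ioc] with s hs
  exact H.norm_fderiv_smear_le hK hs x

end IsAdmissible

/-- The Duhamel integral halves the size of the density, measured with a suitable
exponential weight in time. -/
lemma exists_contraction_rate {ν : ℝ} (hν : 0 < ν) {B : ℝ} (hB : 0 ≤ B) :
    ∃ μ : ℝ, 0 < μ ∧ ∀ (t D : ℝ) (h : ℝ → E3 → E3), 0 ≤ t → 0 ≤ D →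
      IsAdmissible ν t (B * D) μ h → ∀ x,
        ‖duhamel ν h t x‖ + ‖fderiv ℝ (duhamel ν h t) x‖ ≤ D / 2 * Real.exp (μ * t) := by
  obtain ⟨C, hK⟩ := exists_isDecayingProfile_oseenProfile
  have hC := hK.nonneg
  have hW := weightMass_nonneg 4
  have hM : 0 ≤ C * B * weightMass 4 := by positivity
  -- With this `ε` the value and the gradient each contribute at most `D/4`; the added 1 keeps the
  -- denominator positive.
  obtain ⟨μ, hμ, hint⟩ := exists_exp_rate hν
    (ε := 1 / (4 * (C * B * weightMass 4 + 1))) (by positivity)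
  refine ⟨μ, hμ, fun t D h ht hD H x => ?_⟩
  have h1 := H.norm_duhamel_le hK hν ht x
  have h2 := H.norm_fderiv_duhamel_le hK hν ht x
  have e : ∫ s in Ioc 0 t, C * (B * D * Real.exp (μ * s)) * weightMass 4 *
      (1 + invLength ν (t - s)) = C * B * weightMass 4 * D *
        ∫ s in (0 : ℝ)..t, (1 + invLength ν (t - s)) * Real.exp (μ * s) := by
    rw [intervalIntegral.integral_of_le ht, ← integral_const_mul]
    congr 1
    funext s
    ring
  rw [e] at h1 h2
  have h3 : C * B * weightMass 4 * D *
      ∫ s in (0 : ℝ)..t, (1 + invLength ν (t - s)) * Real.exp (μ * s) ≤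
      D / 4 * Real.exp (μ * t) := by
    calc _ ≤ C * B * weightMass 4 * D *
          (1 / (4 * (C * B * weightMass 4 + 1)) * Real.exp (μ * t)) := by
          gcongr
          exact hint t ht
      _ = C * B * weightMass 4 / (C * B * weightMass 4 + 1) * (D / 4 * Real.exp (μ * t)) := by
          field_simp
      _ ≤ 1 * (D / 4 * Real.exp (μ * t)) := by
          gcongr
          rw [div_le_one (by positivity)]
          linarith
      _ = _ := one_mul _
  linarith

/-! ### Joint measurability in time and space. -/

section Measurability

/-- Joint measurability on `[0,T] × ℝ³`. -/
def MeasurableOnSlab (T : ℝ) (h : ℝ → E3 → E3) : Prop :=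
  ∃ g : ℝ × E3 → E3, Measurable g ∧ ∀ t ∈ Icc (0 : ℝ) T, ∀ x, h t x = g (t, x)

variable {T ν : ℝ} {h k : ℝ → E3 → E3}

lemma MeasurableOnSlab.add (hh : MeasurableOnSlab T h) (hk : MeasurableOnSlab T k) :
    MeasurableOnSlab T (fun t x => h t x + k t x) := by
  obtain ⟨g, hg, e⟩ := hh
  obtain ⟨g', hg', e'⟩ := hk
  exact ⟨fun p => g p + g' p, hg.add hg', fun t ht x => by
    simp only [e t ht, e' t ht]⟩

lemma MeasurableOnSlab.neg (hh : MeasurableOnSlab T h) :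
    MeasurableOnSlab T (fun t x => -h t x) := by
  obtain ⟨g, hg, e⟩ := hh
  exact ⟨fun p => -g p, hg.neg, fun t ht x => by
    simp only [e t ht]⟩

lemma MeasurableOnSlab.of_tendsto {u : ℕ → ℝ → E3 → E3} (hu : ∀ n, MeasurableOnSlab T (u n))
    (hlim : ∀ t ∈ Icc (0 : ℝ) T, ∀ x, Tendsto (fun n => u n t x) atTop (𝓝 (h t x))) :
    MeasurableOnSlab T h := by
  choose g hg e using hu
  let S : Set (ℝ × E3) := Icc 0 T ×ˢ univ
  have hS : MeasurableSet S := measurableSet_Icc.prod MeasurableSet.univ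
  refine ⟨S.indicator fun p => h p.1 p.2, ?_, fun t ht x => ?_⟩
  · refine measurable_of_tendsto_metrizable (f := fun n => S.indicator (g n))
      (fun n => (hg n).indicator hS) (tendsto_pi_nhds.2 fun p => ?_)
    by_cases hp : p ∈ S
    · simp only [indicator_of_mem hp]
      refine (hlim p.1 hp.1 p.2).congr fun n => e n p.1 hp.1 p.2
    · simp only [indicator_of_notMem hp]
      exact tendsto_const_nhds
  · rw [indicator_of_mem (show (t, x) ∈ S from ⟨ht, mem_univ _⟩)]

/-- The convective term is the derivative of the field along its own value. It is therefore a limit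
of the quotients `n(h(x + h(x)/n) - h(x))`, which are compositions of measurable maps. -/
lemma MeasurableOnSlab.convection (hh : MeasurableOnSlab T h)
    (hd : ∀ t ∈ Icc (0 : ℝ) T, Differentiable ℝ (h t)) :
    MeasurableOnSlab T (fun t x => convection (h t) x) := by
  obtain ⟨g, hg, e⟩ := hh
  refine MeasurableOnSlab.of_tendsto
    (u := fun n t x => (n : ℝ) • (h t (x + (n : ℝ)⁻¹ • h t x) - h t x)) (fun n => ?_)
    (fun t ht x => ?_)
  · refine ⟨fun p => (n : ℝ) • (g (p.1, p.2 + (n : ℝ)⁻¹ • g p) - g p), ?_,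
      fun t ht x => by simp only [e t ht]⟩
    exact ((hg.comp (measurable_fst.prodMk (measurable_snd.add (hg.const_smul (n : ℝ)⁻¹)))).sub
      hg).const_smul (n : ℝ)
  · exact ((hd t ht x).hasFDerivAt.lim_real (h t x)).comp tendsto_natCast_atTop_atTop

lemma IsDecayingProfile.continuous_dilate {K : E3 → E3 →L[ℝ] E3} {C : ℝ}
    (hK : IsDecayingProfile K C) :
    Continuous fun q : ℝ × E3 × E3 => dilate K q.1 q.2.1 q.2.2 := by
  have h1 : Continuous fun q : ℝ × E3 × E3 => K (q.1 • q.2.1) :=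
    hK.contDiff.continuous.comp (by fun_prop)
  have h2 : Continuous fun q : ℝ × E3 × E3 => dilate K q.1 q.2.1 :=
    (continuous_fst.pow 3).smul h1
  exact h2.clm_apply (by fun_prop)

lemma IsDecayingProfile.measurable_dilate {K : E3 → E3 →L[ℝ] E3} {C : ℝ}
    (hK : IsDecayingProfile K C) {α : Type*} [MeasurableSpace α] {τ : α → ℝ} {z w : α → E3}
    (hτ : Measurable τ) (hz : Measurable z) (hw : Measurable w) :
    Measurable fun a => dilate K (invLength ν (τ a)) (z a) (w a) := by
  have h1 : Measurable fun a => (invLength ν (τ a), z a, w a) :=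
    ((measurable_invLength ν).comp hτ).prodMk (hz.prodMk hw)
  have h2 := hK.continuous_dilate.measurable.comp h1
  exact h2

lemma MeasurableOnSlab.isAdmissible (hh : MeasurableOnSlab T h) (hν : 0 < ν) {t A μ : ℝ}
    (ht : t ∈ Icc (0 : ℝ) T) (hA : 0 ≤ A)
    (hb : ∀ s ∈ Icc (0 : ℝ) T, ∀ y, ‖h s y‖ ≤ A * Real.exp (μ * s) * weight 1 y) :
    IsAdmissible ν t A μ h := by
  obtain ⟨g, hg, e⟩ := hh
  obtain ⟨C, hK⟩ := exists_isDecayingProfile_oseenProfile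
  have hmem : ∀ s ∈ Ioc 0 t, s ∈ Icc 0 T := fun s hs => ⟨hs.1.le, hs.2.trans ht.2⟩
  refine ⟨hA, fun x => ?_, fun s hs => ?_, fun s hs => hb s (hmem s hs)⟩
  · have hm : Measurable fun p : ℝ × E3 =>
        dilate oseenProfile (invLength ν (t - p.1)) (x - p.2) (g p) :=
      hK.measurable_dilate (by fun_prop) (by fun_prop) hg
    refine hm.aestronglyMeasurable.congr ?_
    have : ∀ᵐ p : ℝ × E3 ∂((volume.restrict (Ioc 0 t)).prod volume), p.1 ∈ Ioc 0 t :=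
      Measure.quasiMeasurePreserving_fst.ae (ae_restrict_mem measurableSet_Ioc)
    filter_upwards [this] with p hp
    rw [applyG_eq (mul_nonneg hν.le (sub_nonneg.2 hp.2)), e p.1 (hmem _ hp)]
  · rw [funext (e s (hmem s hs))]
    exact (hg.comp measurable_prodMk_left).aestronglyMeasurable

lemma MeasurableOnSlab.duhamel (hh : MeasurableOnSlab T h) (hν : 0 < ν) :
    MeasurableOnSlab T (duhamel ν h) := by
  obtain ⟨g, hg, e⟩ := hh
  obtain ⟨C, hK⟩ := exists_isDecayingProfile_oseenProfile
  -- The time interval varies with `t`. Encoding it as an indicator on a measurable set gives an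
  -- integral over a fixed space, to which measurability of parametric integrals applies.
  let S : Set ((ℝ × E3) × ℝ) := {q | 0 < q.2 ∧ q.2 ≤ q.1.1}
  have hS : MeasurableSet S := (measurableSet_lt measurable_const measurable_snd).inter
    (measurableSet_le measurable_snd (measurable_fst.comp measurable_fst))
  have h1 : StronglyMeasurable fun q : (ℝ × E3) × ℝ => ∫ y,
      dilate oseenProfile (invLength ν (q.1.1 - q.2)) (q.1.2 - y) (g (q.2, y)) := by
    refine StronglyMeasurable.integral_prod_right (Measurable.stronglyMeasurable ?_)
    exact hK.measurable_dilate (by fun_prop) (by fun_prop) (hg.comp (by fun_prop))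
  have h2 := (StronglyMeasurable.integral_prod_right' (ν := (volume : Measure ℝ))
    (h1.indicator hS)).measurable
  refine ⟨_, h2, fun t ht x => ?_⟩
  rw [duhamel_eq hν ht.1, ← integral_indicator measurableSet_Ioc]
  congr 1
  funext s
  by_cases hs : s ∈ Ioc 0 t
  · rw [indicator_of_mem hs, indicator_of_mem (show ((t, x), s) ∈ S from hs), smear]
    simp_rw [e s ⟨hs.1.le, hs.2.trans ht.2⟩]
  · rw [indicator_of_notMem hs, indicator_of_notMem (show ((t, x), s) ∉ S from hs)]

lemma measurableOnSlab_heatFlow (ν : ℝ) {v₀ : E3 → E3} (hv₀ : Measurable v₀) (T : ℝ) :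
    MeasurableOnSlab T (heatFlow ν v₀) := by
  refine ⟨fun p => heatFlow ν v₀ p.1 p.2, ?_, fun _ _ _ => rfl⟩
  unfold heatFlow
  refine Measurable.ite (measurable_fst (measurableSet_singleton 0))
    (hv₀.comp measurable_snd) ?_
  refine (StronglyMeasurable.integral_prod_right (f := fun (p : ℝ × E3) y =>
    heatKernel ν p.1 (p.2 - y) • v₀ y) (Measurable.stronglyMeasurable ?_)).measurable
  unfold heatKernel
  have : Measurable fun q : (ℝ × E3) × E3 => v₀ q.2 := hv₀.comp measurable_snd
  have h2 : Measurable fun q : (ℝ × E3) × E3 => Real.exp (-‖q.1.2 - q.2‖ ^ 2 / (4 * ν * q.1.1)) /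
      (4 * ν * q.1.1 * Real.pi) ^ ((3 : ℝ) / 2) := by fun_prop
  exact h2.smul this

end Measurability

/-! ### Subtractivity of convergent Duhamel integrals. -/

section Duhamel

variable {ν t : ℝ} {h k : ℝ → E3 → E3}

lemma applyG_sub (ν t : ℝ) (x w w' : E3) :
    applyG ν t x (w - w') = applyG ν t x w - applyG ν t x w' := by
  ext j
  simp [applyG, mul_sub, Finset.sum_sub_distrib]

lemma DuhamelConverges.sub {x : E3} (hh : DuhamelConverges ν h t x)
    (hk : DuhamelConverges ν k t x) : DuhamelConverges ν (fun s y => h s y - k s y) t x := by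
  unfold DuhamelConverges
  simp_rw [applyG_sub]
  exact Integrable.sub hh hk

lemma duhamel_eq_integral_prod {x : E3} (ht : 0 ≤ t) (hh : DuhamelConverges ν h t x) :
    duhamel ν h t x = ∫ p : ℝ × E3, applyG ν (t - p.1) (x - p.2) (h p.1 p.2)
      ∂((volume.restrict (Ioc 0 t)).prod volume) := by
  rw [duhamel, intervalIntegral.integral_of_le ht, integral_prod _ hh]

lemma duhamel_sub {x : E3} (ht : 0 ≤ t) (hh : DuhamelConverges ν h t x)
    (hk : DuhamelConverges ν k t x) :
    duhamel ν (fun s y => h s y - k s y) t x = duhamel ν h t x - duhamel ν k t x := by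
  rw [duhamel_eq_integral_prod ht (hh.sub hk), duhamel_eq_integral_prod ht hh,
    duhamel_eq_integral_prod ht hk, ← integral_sub hh hk]
  simp_rw [applyG_sub]

end Duhamel

/-! ### Heat flow of the datum and spatial decay. -/

section HeatFlow

variable {ν A t : ℝ} {v₀ : E3 → E3}

lemma heatFlow_zero (ν : ℝ) (v₀ : E3 → E3) : heatFlow ν v₀ 0 = v₀ := by
  funext x
  simp [heatFlow]

lemma heatFlow_eq_smear (hν : 0 < ν) (ht : 0 < t) :
    heatFlow ν v₀ t = smear heatProfile (invLength ν t) v₀ := by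
  funext x
  rw [heatFlow, if_neg ht.ne', smear]
  simp_rw [heatKernel_smul_eq (mul_pos hν ht).le]

lemma weight_one_sq_le (x : E3) : weight 1 x ^ (2 : ℝ) ≤ weight 1 x := by
  rw [Real.rpow_ofNat, sq]
  exact mul_le_of_le_one_left (weight_nonneg zero_le_one x) (weight_one_le_one x)

lemma contDiff_heatFlow (hν : 0 < ν) (ht : 0 ≤ t) (hv₀ : ContDiff ℝ 1 v₀) (hA : 0 ≤ A)
    (hb : ∀ x, ‖v₀ x‖ ≤ A * weight 1 x ^ (2 : ℝ)) : ContDiff ℝ 1 (heatFlow ν v₀ t) := by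
  rcases ht.eq_or_lt with rfl | ht
  · rwa [heatFlow_zero]
  · obtain ⟨C, hK⟩ := exists_isDecayingProfile_heatProfile
    rw [heatFlow_eq_smear hν ht]
    exact hK.contDiff_smear (invLength_nonneg _ _) hv₀.continuous.aestronglyMeasurable
      (fun y => (hb y).trans (mul_le_mul_of_nonneg_left (weight_one_sq_le y) hA)) hA

lemma exists_norm_heatFlow_le (hν : 0 < ν) (ht : 0 ≤ t) (hA : 0 ≤ A)
    (hb : ∀ x, ‖v₀ x‖ ≤ A * weight 1 x ^ (2 : ℝ)) :
    ∃ M, ∀ x, ‖heatFlow ν v₀ t x‖ ≤ M * (1 + ‖x‖) ^ (-(7 / 4) : ℝ) := by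
  rcases ht.eq_or_lt with rfl | ht
  · refine ⟨A, fun x => ?_⟩
    rw [heatFlow_zero]
    refine (hb x).trans ?_
    rw [weight_one_rpow]
    gcongr
    · linarith [norm_nonneg x]
    · norm_num
  · obtain ⟨C, hK⟩ := exists_isDecayingProfile_heatProfile
    rw [heatFlow_eq_smear hν ht]
    exact ⟨_, hK.norm_smear_le_rpow (invLength_nonneg _ _) hb hA⟩

/-- The `7/4` decay of each convolution costs a factor `1 + l^(1/4) ≤ 2 + l`, still integrable in
time, so the decay survives integration. -/
lemma exists_norm_duhamel_le (hν : 0 < ν) (ht : 0 ≤ t) (hA : 0 ≤ A) {h : ℝ → E3 → E3}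
    (hb : ∀ s ∈ Ioc 0 t, ∀ x, ‖h s x‖ ≤ A * weight 1 x ^ (2 : ℝ)) :
    ∃ M, ∀ x, ‖duhamel ν h t x‖ ≤ M * (1 + ‖x‖) ^ (-(7 / 4) : ℝ) := by
  obtain ⟨C, hK⟩ := exists_isDecayingProfile_oseenProfile
  have hC := hK.nonneg
  have hW := weightMass_nonneg (13 / 4)
  have hi : IntegrableOn (fun s => 2 + invLength ν (t - s)) (Ioc 0 t) := by
    rw [← intervalIntegrable_iff_integrableOn_Ioc_of_le ht]
    exact intervalIntegrable_const.add (intervalIntegrable_invLength_sub hν ht)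
  set M := C * A * (2 * 2 ^ (7 / 4 : ℝ)) * weightMass (13 / 4) with hM
  have hM0 : 0 ≤ M := by positivity
  refine ⟨M * ∫ s in Ioc 0 t, (2 + invLength ν (t - s)), fun x => ?_⟩
  rw [duhamel_eq hν ht]
  refine (norm_integral_le_of_norm_le
    ((hi.const_mul M).mul_const ((1 + ‖x‖) ^ (-(7 / 4) : ℝ))) ?_).trans (le_of_eq ?_)
  · filter_upwards [ae_restrict_mem measurableSet_Ioc] with s hs
    refine (hK.norm_smear_le_rpow (invLength_nonneg _ _) (hb s hs) hA x).trans ?_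
    rw [← hM]
    have hl := invLength_nonneg ν (t - s)
    have : invLength ν (t - s) ^ (1 / 4 : ℝ) ≤ 1 + invLength ν (t - s) := by
      rcases le_total (invLength ν (t - s)) 1 with h1 | h1
      · linarith [Real.rpow_le_one hl h1 (show (0 : ℝ) ≤ 1 / 4 by norm_num)]
      · have := Real.rpow_le_rpow_of_exponent_le h1 (show (1 / 4 : ℝ) ≤ 1 by norm_num)
        rw [Real.rpow_one] at this
        linarith
    refine mul_le_mul_of_nonneg_right (mul_le_mul_of_nonneg_left ?_ hM0) (by positivity)
    linarith
  · rw [integral_mul_const, integral_const_mul]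

end HeatFlow

/-! ### Weighted bounds and differences of convective terms. -/

section Bounds

variable {T B : ℝ}

/-- `(|v| + |∇v|) (1 + |x|) ≤ B` on `[0,T] × ℝ³`. -/
def BoundedBy (T B : ℝ) (v : ℝ → E3 → E3) : Prop :=
  ∀ t ∈ Icc (0 : ℝ) T, ∀ x, ‖v t x‖ + ‖fderiv ℝ (v t) x‖ ≤ B * weight 1 x

lemma le_mul_weight_one_iff {b : ℝ} {x : E3} : b ≤ B * weight 1 x ↔ b * (1 + ‖x‖) ≤ B := by
  rw [weight, one_mul, mul_one_div, le_div_iff₀ (by positivity)]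

lemma boundedBy_of_N1_le {v : ℝ → E3 → E3} {M : ℝ≥0∞} (hM : M < ⊤) (h : N1 T v ≤ M) :
    BoundedBy T M.toReal v := by
  intro t ht x
  rw [le_mul_weight_one_iff]
  have h1 : ENNReal.ofReal ((‖v t x‖ + ‖fderiv ℝ (v t) x‖) * (1 + ‖x‖)) ≤ M :=
    le_trans (le_iSup₂_of_le (f := fun t _ => ⨆ x, ENNReal.ofReal
      ((‖v t x‖ + ‖fderiv ℝ (v t) x‖) * (1 + ‖x‖))) t ht (le_iSup (fun x => ENNReal.ofReal
      ((‖v t x‖ + ‖fderiv ℝ (v t) x‖) * (1 + ‖x‖))) x)) h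
  exact (ENNReal.ofReal_le_iff_le_toReal hM.ne).1 h1

lemma BoundedBy.N1_lt_top {v : ℝ → E3 → E3} (h : BoundedBy T B v) : N1 T v < ⊤ :=
  lt_of_le_of_lt (iSup₂_le fun t ht => iSup_le fun x =>
    ENNReal.ofReal_le_ofReal (le_mul_weight_one_iff.1 (h t ht x))) ENNReal.ofReal_lt_top

lemma BoundedBy.mono {v : ℝ → E3 → E3} (h : BoundedBy T B v) {B' : ℝ} (hB : B ≤ B') :
    BoundedBy T B' v := fun t ht x =>
  (h t ht x).trans (mul_le_mul_of_nonneg_right hB (weight_nonneg zero_le_one x))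

lemma BoundedBy.norm_convection_le {v : ℝ → E3 → E3} (h : BoundedBy T B v) {t : ℝ}
    (ht : t ∈ Icc (0 : ℝ) T) (x : E3) :
    ‖convection (v t) x‖ ≤ B ^ 2 * weight 1 x ^ (2 : ℝ) := by
  have h1 := h t ht x
  have h2 := norm_nonneg (v t x)
  have h3 := norm_nonneg (fderiv ℝ (v t) x)
  calc ‖convection (v t) x‖ ≤ ‖fderiv ℝ (v t) x‖ * ‖v t x‖ := ContinuousLinearMap.le_opNorm _ _
    _ ≤ (B * weight 1 x) * (B * weight 1 x) := by gcongr <;> linarith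
    _ = _ := by rw [Real.rpow_ofNat]; ring

lemma continuous_convection {u : E3 → E3} (hu : ContDiff ℝ 1 u) : Continuous (convection u) :=
  (hu.continuous_fderiv one_ne_zero).clm_apply hu.continuous

/-- `v` and `w` differ, with their gradients, by at most `D exp (μ t)`. -/
def CloseBy (T μ D : ℝ) (v w : ℝ → E3 → E3) : Prop :=
  ∀ t ∈ Icc (0 : ℝ) T, ∀ x,
    ‖v t x - w t x‖ + ‖fderiv ℝ (v t) x - fderiv ℝ (w t) x‖ ≤ D * Real.exp (μ * t)

/-- In `(v·∇)v - (w·∇)w = ((v-w)·∇)v + (w·∇)(v-w)` each term has one factor bounded by `B/(1+|x|)`.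
The difference itself needs no spatial weight. -/
lemma CloseBy.norm_convection_sub_le {v w : ℝ → E3 → E3} {μ D : ℝ} (h : CloseBy T μ D v w)
    (hv : BoundedBy T B v) (hw : BoundedBy T B w) (hB : 0 ≤ B) {t : ℝ} (ht : t ∈ Icc (0 : ℝ) T)
    (x : E3) :
    ‖convection (v t) x - convection (w t) x‖ ≤ B * D * Real.exp (μ * t) * weight 1 x := by
  have h0 := h t ht x
  have h1 := hv t ht x
  have h2 := hw t ht x
  have h3 := weight_nonneg zero_le_one x
  have e : convection (v t) x - convection (w t) x = fderiv ℝ (v t) x (v t x - w t x) +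
      (fderiv ℝ (v t) x - fderiv ℝ (w t) x) (w t x) := by
    simp [convection]
  rw [e]
  calc _ ≤ ‖fderiv ℝ (v t) x‖ * ‖v t x - w t x‖ +
        ‖fderiv ℝ (v t) x - fderiv ℝ (w t) x‖ * ‖w t x‖ :=
        (norm_add_le _ _).trans (add_le_add (ContinuousLinearMap.le_opNorm _ _)
          (ContinuousLinearMap.le_opNorm _ _))
    _ ≤ (B * weight 1 x) * ‖v t x - w t x‖ +
        ‖fderiv ℝ (v t) x - fderiv ℝ (w t) x‖ * (B * weight 1 x) := by
        gcongr
        · linarith [norm_nonneg (v t x)]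
        · linarith [norm_nonneg (fderiv ℝ (w t) x)]
    _ = (B * weight 1 x) * (‖v t x - w t x‖ + ‖fderiv ℝ (v t) x - fderiv ℝ (w t) x‖) := by ring
    _ ≤ (B * weight 1 x) * (D * Real.exp (μ * t)) := by gcongr
    _ = _ := by ring

/-- Joint measurability of the fields is not at hand for arbitrary solutions. Measurability of the
kernel integrand comes from the absolute convergence, and that of time slices from continuity in
`x`. -/
lemma CloseBy.isAdmissible {ν : ℝ} {v w : ℝ → E3 → E3} {μ D : ℝ} (h : CloseBy T μ D v w)
    (hv : BoundedBy T B v) (hw : BoundedBy T B w) (hB : 0 ≤ B) (hD : 0 ≤ D)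
    (hvc : ∀ t ∈ Icc (0 : ℝ) T, ContDiff ℝ 1 (v t)) (hwc : ∀ t ∈ Icc (0 : ℝ) T, ContDiff ℝ 1 (w t))
    {t : ℝ} (ht : t ∈ Icc (0 : ℝ) T)
    (hc : ∀ x, DuhamelConverges ν (fun s y => convection (v s) y - convection (w s) y) t x) :
    IsAdmissible ν t (B * D) μ (fun s y => convection (v s) y - convection (w s) y) := by
  have hmem : ∀ s ∈ Ioc 0 t, s ∈ Icc 0 T := fun s hs => ⟨hs.1.le, hs.2.trans ht.2⟩
  refine ⟨mul_nonneg hB hD, fun x => (hc x).aestronglyMeasurable, fun s hs => ?_,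
    fun s hs => h.norm_convection_sub_le hv hw hB (hmem s hs)⟩
  exact ((continuous_convection (hvc s (hmem s hs))).sub
    (continuous_convection (hwc s (hmem s hs)))).aestronglyMeasurable

end Bounds

/-! ### The contraction step and uniqueness. -/

lemma closeBy_of_boundedBy {T B μ : ℝ} (hμ : 0 ≤ μ) (hB : 0 ≤ B) {v w : ℝ → E3 → E3}
    (hv : BoundedBy T B v) (hw : BoundedBy T B w) : CloseBy T μ (2 * B) v w := by
  intro t ht x
  have h1 := hv t ht x
  have h2 := hw t ht x
  have h3 := mul_le_of_le_one_right hB (weight_one_le_one x)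
  have h4 : 1 ≤ Real.exp (μ * t) := Real.one_le_exp (mul_nonneg hμ ht.1)
  have h5 := norm_sub_le (v t x) (w t x)
  have h6 := norm_sub_le (fderiv ℝ (v t) x) (fderiv ℝ (w t) x)
  nlinarith

/-- One application of the Duhamel map halves the distance. The primed fields are the images; their
order is reversed because the convective term enters the equation with a minus sign. -/
lemma closeBy_of_eq_duhamel {ν T B μ D : ℝ} {v w v' w' : ℝ → E3 → E3}
    (hrate : ∀ (t D : ℝ) (h : ℝ → E3 → E3), 0 ≤ t → 0 ≤ D → IsAdmissible ν t (B * D) μ h →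
      ∀ x, ‖duhamel ν h t x‖ + ‖fderiv ℝ (duhamel ν h t) x‖ ≤ D / 2 * Real.exp (μ * t))
    (hB : 0 ≤ B) (hD : 0 ≤ D) (h : CloseBy T μ D v w)
    (hv : BoundedBy T B v) (hw : BoundedBy T B w)
    (hvc : ∀ t ∈ Icc (0 : ℝ) T, ContDiff ℝ 1 (v t)) (hwc : ∀ t ∈ Icc (0 : ℝ) T, ContDiff ℝ 1 (w t))
    (hvc' : ∀ t ∈ Icc (0 : ℝ) T, ContDiff ℝ 1 (v' t))
    (hwc' : ∀ t ∈ Icc (0 : ℝ) T, ContDiff ℝ 1 (w' t))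
    (hc : ∀ t ∈ Icc (0 : ℝ) T, ∀ x,
      DuhamelConverges ν (fun s y => convection (v s) y - convection (w s) y) t x)
    (he : ∀ t ∈ Icc (0 : ℝ) T, ∀ x, w' t x - v' t x =
      duhamel ν (fun s y => convection (v s) y - convection (w s) y) t x) :
    CloseBy T μ (D / 2) w' v' := by
  intro t ht x
  have hd : fderiv ℝ (w' t) x - fderiv ℝ (v' t) x = fderiv ℝ
      (duhamel ν (fun s y => convection (v s) y - convection (w s) y) t) x := by
    rw [← fderiv_fun_sub ((hwc' t ht).differentiable one_ne_zero x)
      ((hvc' t ht).differentiable one_ne_zero x), funext (he t ht)]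
  rw [hd, he t ht]
  exact hrate t D _ ht.1 hD (h.isAdmissible hv hw hB hD hvc hwc ht (hc t ht)) x

lemma CloseBy.symm {T μ D : ℝ} {v w : ℝ → E3 → E3} (h : CloseBy T μ D v w) :
    CloseBy T μ D w v := by
  intro t ht x
  rw [norm_sub_rev, norm_sub_rev (fderiv ℝ (w t) x)]
  exact h t ht x

lemma SolvesOn.unique {ν T : ℝ} (hν : 0 < ν) {f : ℝ → E3 → E3} {v₀ : E3 → E3}
    {v w : ℝ → E3 → E3} (hvX : InX T v) (hv : SolvesOn ν f v₀ T v) (hwX : InX T w)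
    (hw : SolvesOn ν f v₀ T w) : ∀ t ∈ Icc (0 : ℝ) T, ∀ x, v t x = w t x := by
  set B := max (N1 T v).toReal (N1 T w).toReal
  have hB : 0 ≤ B := le_max_of_le_left ENNReal.toReal_nonneg
  have hvB : BoundedBy T B v := (boundedBy_of_N1_le hvX.2 le_rfl).mono (le_max_left _ _)
  have hwB : BoundedBy T B w := (boundedBy_of_N1_le hwX.2 le_rfl).mono (le_max_right _ _)
  obtain ⟨μ, hμ, hrate⟩ := exists_contraction_rate hν hB
  have hsub : ∀ s y, (f s y - convection (w s) y) - (f s y - convection (v s) y) =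
      convection (v s) y - convection (w s) y := fun s y => sub_sub_sub_cancel_left _ _ _
  have hc : ∀ t ∈ Icc (0 : ℝ) T, ∀ x,
      DuhamelConverges ν (fun s y => convection (v s) y - convection (w s) y) t x := by
    intro t ht x
    simpa only [hsub] using (hw t ht x).1.sub (hv t ht x).1
  have he : ∀ t ∈ Icc (0 : ℝ) T, ∀ x, w t x - v t x =
      duhamel ν (fun s y => convection (v s) y - convection (w s) y) t x := by
    intro t ht x
    rw [(hv t ht x).2, (hw t ht x).2, add_sub_add_right_eq_sub,
      ← duhamel_sub ht.1 (hw t ht x).1 (hv t ht x).1]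
    simp only [hsub]
  -- Solutions are their own images, so the halving can be repeated on the same pair, starting from
  -- the crude bound `2B`.
  have hclose : ∀ n : ℕ, CloseBy T μ (2 * B / 2 ^ n) v w := by
    intro n
    induction n with
    | zero => simpa using closeBy_of_boundedBy hμ.le hB hvB hwB
    | succ n ih =>
      have := closeBy_of_eq_duhamel hrate hB (by positivity) ih hvB hwB hvX.1 hwX.1 hvX.1 hwX.1
        hc he
      rw [div_div, ← pow_succ] at this
      exact this.symm
  intro t ht x
  have hlim : Tendsto (fun n : ℕ => 2 * B / 2 ^ n * Real.exp (μ * t)) atTop (𝓝 0) := by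
    have h1 := (tendsto_pow_atTop_nhds_zero_of_lt_one (r := (1 / 2 : ℝ)) (by norm_num)
      (by norm_num)).const_mul (2 * B)
    have h2 := h1.mul_const (Real.exp (μ * t))
    simpa [div_eq_mul_inv] using h2
  have := ge_of_tendsto' hlim fun n => (le_add_of_nonneg_right (norm_nonneg _)).trans
    (hclose n t ht x)
  exact sub_eq_zero.1 (norm_le_zero_iff.1 this)

/-! ### Finiteness of the energy. -/

section Energy

lemma energy_lt_top_of_norm_le {v : ℝ → E3 → E3} {t M : ℝ}
    (h : ∀ x, ‖v t x‖ ≤ M * (1 + ‖x‖) ^ (-(7 / 4) : ℝ)) : energy v t < ⊤ := by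
  have hb : ∀ x, ‖v t x‖ ^ 2 ≤ M ^ 2 * (1 + ‖x‖) ^ (-(7 / 2) : ℝ) := by
    intro x
    refine (pow_le_pow_left₀ (norm_nonneg _) (h x) 2).trans (le_of_eq ?_)
    rw [mul_pow, ← Real.rpow_natCast, ← Real.rpow_natCast, ← Real.rpow_mul (by positivity)]
    norm_num
  calc energy v t ≤ ∫⁻ x : E3, ENNReal.ofReal (M ^ 2 * (1 + ‖x‖) ^ (-(7 / 2) : ℝ)) :=
        lintegral_mono fun x => ENNReal.ofReal_le_ofReal (hb x)
    _ < ⊤ := ((integrable_one_add_norm_rpow (p := 7 / 2) (by norm_num)).const_mul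
        (M ^ 2)).lintegral_lt_top

lemma SolvesOn.energy_lt_top {ν T A A₀ : ℝ} (hν : 0 < ν) {f : ℝ → E3 → E3} {v₀ : E3 → E3}
    (hA : 0 ≤ A) (hf : ∀ t ∈ Icc (0 : ℝ) T, ∀ x, ‖f t x‖ ≤ A * weight 1 x ^ (2 : ℝ))
    (hA₀ : 0 ≤ A₀) (hv₀ : ∀ x, ‖v₀ x‖ ≤ A₀ * weight 1 x ^ (2 : ℝ))
    {v : ℝ → E3 → E3} (hvX : InX T v) (hv : SolvesOn ν f v₀ T v) {t : ℝ}
    (ht : t ∈ Icc (0 : ℝ) T) : energy v t < ⊤ := by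
  have hvB := boundedBy_of_N1_le hvX.2 le_rfl
  obtain ⟨M₁, h₁⟩ := exists_norm_duhamel_le (h := fun s y => f s y - convection (v s) y)
    (A := A + (N1 T v).toReal ^ 2) hν ht.1 (by positivity) fun s hs x => by
      have hs' : s ∈ Icc (0 : ℝ) T := ⟨hs.1.le, hs.2.trans ht.2⟩
      refine (norm_sub_le _ _).trans ?_
      rw [add_mul]
      exact add_le_add (hf s hs' x) (hvB.norm_convection_le hs' x)
  obtain ⟨M₂, h₂⟩ := exists_norm_heatFlow_le hν ht.1 hA₀ hv₀
  refine energy_lt_top_of_norm_le (M := M₁ + M₂) fun x => ?_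
  rw [(hv t ht x).2, add_mul]
  exact (norm_add_le _ _).trans (add_le_add (h₁ x) (h₂ x))

end Energy

/-! ### Convergence of the iterations. -/

/-- The pointwise limit of the iterations. -/
def iterLimit (ν : ℝ) (f : ℝ → E3 → E3) (v₀ : E3 → E3) (t : ℝ) (x : E3) : E3 :=
  limUnder atTop (fun n => iter ν f v₀ n t x)

section Existence

variable {ν T A A₀ B : ℝ} {f : ℝ → E3 → E3} {v₀ : E3 → E3}

lemma isAdmissible_of_norm_le_sq {h : ℝ → E3 → E3} (hh : MeasurableOnSlab T h) (hν : 0 < ν)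
    {t : ℝ} (ht : t ∈ Icc (0 : ℝ) T) (hA : 0 ≤ A)
    (hb : ∀ s ∈ Icc (0 : ℝ) T, ∀ y, ‖h s y‖ ≤ A * weight 1 y ^ (2 : ℝ)) :
    IsAdmissible ν t A 0 h :=
  hh.isAdmissible hν ht hA fun s hs y => (hb s hs y).trans <| by
    rw [zero_mul, Real.exp_zero, mul_one]
    exact mul_le_mul_of_nonneg_left (weight_one_sq_le y) hA

lemma contDiff_sourceF (hν : 0 < ν) (hfm : MeasurableOnSlab T f) (hA : 0 ≤ A)
    (hf : ∀ t ∈ Icc (0 : ℝ) T, ∀ x, ‖f t x‖ ≤ A * weight 1 x ^ (2 : ℝ)) (hv₀ : ContDiff ℝ 1 v₀)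
    (hA₀ : 0 ≤ A₀) (hv₀b : ∀ x, ‖v₀ x‖ ≤ A₀ * weight 1 x ^ (2 : ℝ)) {t : ℝ}
    (ht : t ∈ Icc (0 : ℝ) T) : ContDiff ℝ 1 (sourceF ν f v₀ t) :=
  ((isAdmissible_of_norm_le_sq hfm hν ht hA hf).contDiff_duhamel hν ht.1).add
    (contDiff_heatFlow hν ht.1 hv₀ hA₀ hv₀b)

lemma measurableOnSlab_sourceF (hν : 0 < ν) (hfm : MeasurableOnSlab T f)
    (hv₀ : ContDiff ℝ 1 v₀) : MeasurableOnSlab T (sourceF ν f v₀) :=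
  (hfm.duhamel hν).add (measurableOnSlab_heatFlow ν hv₀.continuous.measurable T)

lemma isAdmissible_convection (hν : 0 < ν) {v : ℝ → E3 → E3} (hm : MeasurableOnSlab T v)
    (hvc : ∀ t ∈ Icc (0 : ℝ) T, ContDiff ℝ 1 (v t)) (hv : BoundedBy T B v) {t : ℝ}
    (ht : t ∈ Icc (0 : ℝ) T) : IsAdmissible ν t (B ^ 2) 0 (fun s y => convection (v s) y) :=
  isAdmissible_of_norm_le_sq (hm.convection fun s hs => (hvc s hs).differentiable one_ne_zero) hν
    ht (sq_nonneg B) fun _ hs y => hv.norm_convection_le hs y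

/-- Smoothness and measurability propagate together: the convective term of one iterate must be
measurable and decaying before its Duhamel integral is `C¹`, and the decay comes from the assumed
bound. -/
lemma iter_regular (hν : 0 < ν) (hfm : MeasurableOnSlab T f) (hA : 0 ≤ A)
    (hf : ∀ t ∈ Icc (0 : ℝ) T, ∀ x, ‖f t x‖ ≤ A * weight 1 x ^ (2 : ℝ)) (hv₀ : ContDiff ℝ 1 v₀)
    (hA₀ : 0 ≤ A₀) (hv₀b : ∀ x, ‖v₀ x‖ ≤ A₀ * weight 1 x ^ (2 : ℝ))
    (hB : ∀ n, BoundedBy T B (iter ν f v₀ n)) (n : ℕ) :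
    (∀ t ∈ Icc (0 : ℝ) T, ContDiff ℝ 1 (iter ν f v₀ n t)) ∧
      MeasurableOnSlab T (iter ν f v₀ n) := by
  induction n with
  | zero => exact ⟨fun t ht => contDiff_sourceF hν hfm hA hf hv₀ hA₀ hv₀b ht,
      measurableOnSlab_sourceF hν hfm hv₀⟩
  | succ n ih =>
    refine ⟨fun t ht => ?_, ?_⟩
    · exact ((isAdmissible_convection hν ih.2 ih.1 (hB n) ht).contDiff_duhamel hν ht.1).neg.add
        (contDiff_sourceF hν hfm hA hf hv₀ hA₀ hv₀b ht)
    · exact ((ih.2.convection fun s hs =>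
        (ih.1 s hs).differentiable one_ne_zero).duhamel hν).neg.add
        (measurableOnSlab_sourceF hν hfm hv₀)

lemma tendsto_N0_of_closeBy {T μ D : ℝ} (hμ : 0 ≤ μ) (hD : 0 ≤ D) {u : ℕ → ℝ → E3 → E3}
    {v : ℝ → E3 → E3} (huc : ∀ n, ∀ t ∈ Icc (0 : ℝ) T, ContDiff ℝ 1 (u n t))
    (hvc : ∀ t ∈ Icc (0 : ℝ) T, ContDiff ℝ 1 (v t))
    (h : ∀ n : ℕ, CloseBy T μ (D / 2 ^ n) (u n) v) :
    Tendsto (fun n => N0 T (fun t x => u n t x - v t x)) atTop (𝓝 0) := by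
  have hlim : Tendsto (fun n : ℕ => ENNReal.ofReal (D / 2 ^ n * Real.exp (μ * T))) atTop
      (𝓝 0) := by
    have h1 := ((tendsto_pow_atTop_nhds_zero_of_lt_one (r := (1 / 2 : ℝ)) (by norm_num)
      (by norm_num)).const_mul D).mul_const (Real.exp (μ * T))
    have h2 := ENNReal.tendsto_ofReal h1
    simpa [div_eq_mul_inv] using h2
  refine tendsto_of_tendsto_of_tendsto_of_le_of_le tendsto_const_nhds hlim (fun _ => bot_le)
    fun n => iSup₂_le fun t ht => iSup_le fun x => ENNReal.ofReal_le_ofReal ?_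
  rw [fderiv_fun_sub ((huc n t ht).differentiable one_ne_zero x)
    ((hvc t ht).differentiable one_ne_zero x)]
  refine (h n t ht x).trans ?_
  gcongr
  exact ht.2

lemma tendsto_of_closeBy {T μ D : ℝ} {u : ℕ → ℝ → E3 → E3} {v : ℝ → E3 → E3}
    (h : ∀ n : ℕ, CloseBy T μ (D / 2 ^ n) (u n) v) {t : ℝ} (ht : t ∈ Icc (0 : ℝ) T) (x : E3) :
    Tendsto (fun n => u n t x) atTop (𝓝 (v t x)) := by
  rw [tendsto_iff_norm_sub_tendsto_zero]
  have h1 := ((tendsto_pow_atTop_nhds_zero_of_lt_one (r := (1 / 2 : ℝ)) (by norm_num)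
    (by norm_num)).const_mul D).mul_const (Real.exp (μ * t))
  refine squeeze_zero (fun _ => norm_nonneg _) (fun n =>
    (le_add_of_nonneg_right (norm_nonneg _)).trans (h n t ht x)) ?_
  simpa [div_eq_mul_inv] using h1

/-- A sequence whose steps decrease geometrically has a limit of class `C¹` in `x`. -/
lemma limit_regular {T μ : ℝ} {u : ℕ → ℝ → E3 → E3} {v : ℝ → E3 → E3} {D : ℝ}
    (huc : ∀ n, ∀ t ∈ Icc (0 : ℝ) T, ContDiff ℝ 1 (u n t))
    (hclose : ∀ n : ℕ, CloseBy T μ (D / 2 ^ n) (u n) (u (n + 1)))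
    (hv : ∀ t x, v t x = limUnder atTop (fun n => u n t x)) :
    (∀ t ∈ Icc (0 : ℝ) T, ContDiff ℝ 1 (v t)) ∧
    ∀ n : ℕ, CloseBy T μ (4 * D / 2 ^ n) (u n) v := by
  have key : ∀ t ∈ Icc (0 : ℝ) T, ContDiff ℝ 1 (v t) ∧ ∀ (n : ℕ) x,
      ‖u n t x - v t x‖ + ‖fderiv ℝ (u n t) x - fderiv ℝ (v t) x‖ ≤
        4 * D / 2 ^ n * Real.exp (μ * t) := by
    intro t ht
    -- `E` is the sum of the geometric series of steps. It bounds the tails of the values and of the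
    -- gradients separately, whence the final constant `4D`.
    set E := 2 * D * Real.exp (μ * t) with hE
    have hE' : ∀ n : ℕ, D / 2 ^ n * Real.exp (μ * t) = E / 2 / 2 ^ n := fun n => by
      rw [hE]; ring
    have h1 : ∀ x (n : ℕ), dist (u n t x) (u (n + 1) t x) ≤ E / 2 / 2 ^ n := fun x n => by
      rw [dist_eq_norm, ← hE']
      exact (le_add_of_nonneg_right (norm_nonneg _)).trans (hclose n t ht x)
    have h2 : ∀ x (n : ℕ), dist (fderiv ℝ (u n t) x) (fderiv ℝ (u (n + 1) t) x) ≤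
        E / 2 / 2 ^ n := fun x n => by
      rw [dist_eq_norm, ← hE']
      exact (le_add_of_nonneg_left (norm_nonneg _)).trans (hclose n t ht x)
    have l1 : ∀ x, Tendsto (fun n => u n t x) atTop (𝓝 (v t x)) := fun x => by
      rw [hv]
      exact tendsto_nhds_limUnder
        (cauchySeq_tendsto_of_complete (cauchySeq_of_le_geometric_two (h1 x)))
    choose W l2 using fun x => cauchySeq_tendsto_of_complete
      (cauchySeq_of_le_geometric_two (h2 x))
    have d1 : ∀ x (n : ℕ), dist (u n t x) (v t x) ≤ E / 2 ^ n := fun x n =>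
      dist_le_of_le_geometric_two_of_tendsto (h1 x) (l1 x) n
    have d2 : ∀ x (n : ℕ), dist (fderiv ℝ (u n t) x) (W x) ≤ E / 2 ^ n := fun x n =>
      dist_le_of_le_geometric_two_of_tendsto (h2 x) (l2 x) n
    have hunif : TendstoUniformly (fun n x => fderiv ℝ (u n t) x) W atTop := by
      rw [Metric.tendstoUniformly_iff]
      intro ε hε
      have hlim : Tendsto (fun n : ℕ => E / 2 ^ n) atTop (𝓝 0) := by
        have := (tendsto_pow_atTop_nhds_zero_of_lt_one (r := (1 / 2 : ℝ)) (by norm_num)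
          (by norm_num)).const_mul E
        simpa [div_eq_mul_inv] using this
      filter_upwards [hlim.eventually (gt_mem_nhds hε)] with n hn x
      rw [dist_comm]
      exact (d2 x n).trans_lt hn
    have hder : ∀ x, HasFDerivAt (v t) (W x) x := hasFDerivAt_of_tendstoUniformly hunif
      (fun n x => ((huc n t ht).differentiable one_ne_zero x).hasFDerivAt) l1
    have hfd : fderiv ℝ (v t) = W := funext fun x => (hder x).fderiv
    refine ⟨?_, fun n x => ?_⟩
    · rw [contDiff_one_iff_fderiv]
      refine ⟨fun x => (hder x).differentiableAt, ?_⟩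
      rw [hfd]
      exact hunif.continuous
        (Frequently.of_forall fun n => (huc n t ht).continuous_fderiv one_ne_zero)
    · rw [hfd, ← dist_eq_norm, ← dist_eq_norm]
      have := add_le_add (d1 x n) (d2 x n)
      refine this.trans (le_of_eq ?_)
      rw [hE]
      ring
  exact ⟨fun t ht => (key t ht).1, fun n t ht x => (key t ht).2 n x⟩

lemma BoundedBy.of_closeBy {T μ D : ℝ} {u : ℕ → ℝ → E3 → E3} {v : ℝ → E3 → E3}
    (hB : ∀ n, BoundedBy T B (u n)) (h : ∀ n : ℕ, CloseBy T μ (D / 2 ^ n) (u n) v) :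
    BoundedBy T B v := by
  intro t ht x
  have hlim : Tendsto (fun n : ℕ => D / 2 ^ n * Real.exp (μ * t) + B * weight 1 x) atTop
      (𝓝 (B * weight 1 x)) := by
    have h1 := (((tendsto_pow_atTop_nhds_zero_of_lt_one (r := (1 / 2 : ℝ)) (by norm_num)
      (by norm_num)).const_mul D).mul_const (Real.exp (μ * t))).add_const (B * weight 1 x)
    simpa [div_eq_mul_inv] using h1
  refine ge_of_tendsto' hlim fun n => ?_
  have h1 := h n t ht x
  have h2 := hB n t ht x
  have h3 := norm_sub_norm_le (v t x) (u n t x)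
  have h4 := norm_sub_norm_le (fderiv ℝ (v t) x) (fderiv ℝ (u n t) x)
  rw [norm_sub_rev] at h3 h4
  linarith

lemma iterLimit_spec (hν : 0 < ν) (hfm : MeasurableOnSlab T f) (hA : 0 ≤ A)
    (hf : ∀ t ∈ Icc (0 : ℝ) T, ∀ x, ‖f t x‖ ≤ A * weight 1 x ^ (2 : ℝ)) (hv₀ : ContDiff ℝ 1 v₀)
    (hA₀ : 0 ≤ A₀) (hv₀b : ∀ x, ‖v₀ x‖ ≤ A₀ * weight 1 x ^ (2 : ℝ))
    (hN : (⨆ n, N1 T (iter ν f v₀ n)) < ⊤) :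
    InX T (iterLimit ν f v₀) ∧ SolvesOn ν f v₀ T (iterLimit ν f v₀) ∧
      Tendsto (fun n => N0 T (fun t x => iter ν f v₀ n t x - iterLimit ν f v₀ t x)) atTop
        (𝓝 0) := by
  set u := iter ν f v₀ with hu
  set v := iterLimit ν f v₀ with hv
  set B := (⨆ n, N1 T (u n)).toReal
  have hB : 0 ≤ B := ENNReal.toReal_nonneg
  have huB : ∀ n, BoundedBy T B (u n) := fun n =>
    boundedBy_of_N1_le hN (le_iSup (fun n => N1 T (u n)) n)
  have hreg := iter_regular hν hfm hA hf hv₀ hA₀ hv₀b huB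
  have huc : ∀ n, ∀ t ∈ Icc (0 : ℝ) T, ContDiff ℝ 1 (u n t) := fun n => (hreg n).1
  have hconv : ∀ n, ∀ t ∈ Icc (0 : ℝ) T, ∀ x,
      DuhamelConverges ν (fun s y => convection (u n s) y) t x := fun n t ht x =>
    (isAdmissible_convection hν (hreg n).2 (huc n) (huB n) ht).duhamelConverges hν ht.1 x
  obtain ⟨μ, hμ, hrate⟩ := exists_contraction_rate hν hB
  have hsucc : ∀ n t x, u (n + 1) t x =
      -duhamel ν (fun s y => convection (u n s) y) t x + sourceF ν f v₀ t x := fun _ _ _ => rfl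
  have hclose : ∀ n : ℕ, CloseBy T μ (2 * B / 2 ^ n) (u n) (u (n + 1)) := by
    intro n
    induction n with
    | zero => simpa using closeBy_of_boundedBy hμ.le hB (huB 0) (huB 1)
    | succ n ih =>
      have := closeBy_of_eq_duhamel (v' := u (n + 2)) (w' := u (n + 1)) hrate hB (by positivity)
        ih.symm (huB _) (huB _) (huc _) (huc _) (huc _) (huc _)
        (fun t ht x => (hconv _ t ht x).sub (hconv _ t ht x)) (fun t ht x => by
          rw [duhamel_sub ht.1 (hconv _ t ht x) (hconv _ t ht x), hsucc, hsucc]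
          abel)
      rwa [div_div, ← pow_succ] at this
  obtain ⟨hvc, hlim⟩ := limit_regular (v := v) huc hclose fun _ _ => rfl
  have hvB : BoundedBy T B v := BoundedBy.of_closeBy huB hlim
  have hvm : MeasurableOnSlab T v := MeasurableOnSlab.of_tendsto (fun n => (hreg n).2)
    fun t ht x => tendsto_of_closeBy hlim ht x
  have hvconv : ∀ t ∈ Icc (0 : ℝ) T, ∀ x,
      DuhamelConverges ν (fun s y => convection (v s) y) t x := fun t ht x =>
    (isAdmissible_convection hν hvm hvc hvB ht).duhamelConverges hν ht.1 x
  refine ⟨⟨hvc, hvB.N1_lt_top⟩, fun t ht x => ?_,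
    tendsto_N0_of_closeBy hμ.le (by positivity) huc hvc hlim⟩
  have hfc := (isAdmissible_of_norm_le_sq hfm hν ht hA hf).duhamelConverges hν ht.1 x
  refine ⟨hfc.sub (hvconv t ht x), ?_⟩
  rw [duhamel_sub ht.1 hfc (hvconv t ht x)]
  -- The contraction estimate applied to an iterate and the limit bounds the difference of their
  -- Duhamel terms by half their distance, which tends to zero.
  have hd : Tendsto (fun n => duhamel ν (fun s y => convection (u n s) y) t x) atTop
      (𝓝 (duhamel ν (fun s y => convection (v s) y) t x)) := by
    rw [tendsto_iff_norm_sub_tendsto_zero]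
    have h1 := ((tendsto_pow_atTop_nhds_zero_of_lt_one (r := (1 / 2 : ℝ)) (by norm_num)
      (by norm_num)).const_mul (4 * (2 * B))).mul_const (1 / 2 * Real.exp (μ * t))
    refine squeeze_zero (fun _ => norm_nonneg _) (fun n => ?_) (by simpa using h1)
    rw [← duhamel_sub ht.1 (hconv n t ht x) (hvconv t ht x)]
    have h2 := hrate t _ _ ht.1 (by positivity) ((hlim n).isAdmissible (ν := ν) (huB n) hvB hB
      (by positivity) (huc n) hvc ht fun x => (hconv n t ht x).sub (hvconv t ht x)) x
    refine (le_add_of_nonneg_right (norm_nonneg _)).trans (h2.trans (le_of_eq ?_))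
    ring
  -- The recursion expresses the iterate of index `n+1`, so the shifted sequence converges both to
  -- the limit and to the right-hand side of the integral equation.
  have h1 := (tendsto_of_closeBy hlim ht x).comp (tendsto_add_atTop_nat 1)
  have h2 := tendsto_nhds_unique h1 (hd.neg.add_const (sourceF ν f v₀ t x))
  rw [h2, sourceF]
  abel

end Existence

/-! ### From the decay of the data to the theorem. -/

lemma rpow_neg_le_weight {a C b : ℝ} (ha : 3 < a) {x : E3}
    (h : b ≤ C * (1 + ‖x‖) ^ (-a)) : b ≤ |C| * weight 1 x ^ (2 : ℝ) := by
  rw [weight_one_rpow]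
  calc b ≤ C * (1 + ‖x‖) ^ (-a) := h
    _ ≤ |C| * (1 + ‖x‖) ^ (-a) := by gcongr; exact le_abs_self C
    _ ≤ |C| * (1 + ‖x‖) ^ (-2 : ℝ) := by
        gcongr
        · linarith [norm_nonneg x]
        · linarith

end NavierStokes

end

theorem theorem1 (ν : ℝ) (hν : 0 < ν) (a : ℝ) (ha : 3 < a)
    (v₀ : NavierStokes.E3 → NavierStokes.E3) (f : ℝ → NavierStokes.E3 → NavierStokes.E3)
    (hv₀ : ContDiff ℝ 1 v₀)
    (hv₀_div : ∀ x, NavierStokes.divergence v₀ x = 0)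
    (hv₀_decay : ∃ C : ℝ, ∀ x, ‖v₀ x‖ + ‖fderiv ℝ v₀ x‖ ≤ C * (1 + ‖x‖) ^ (-a))
    (hf_meas : Measurable (fun p : ℝ × NavierStokes.E3 => f p.1 p.2))
    (hf_diff : ∀ t : ℝ, 0 ≤ t → Differentiable ℝ (f t))
    (hf_decay : ∀ T : ℝ, 0 < T → ∃ C : ℝ, ∀ t ∈ Icc (0 : ℝ) T, ∀ x,
      ‖f t x‖ + ‖fderiv ℝ (f t) x‖ ≤ C * (1 + ‖x‖) ^ (-a)) :
    -- uniqueness in `X`, on every time interval `[0,T]`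
    (∀ T : ℝ, 0 < T → ∀ v w : ℝ → NavierStokes.E3 → NavierStokes.E3,
      NavierStokes.InX T v → NavierStokes.SolvesOn ν f v₀ T v →
      NavierStokes.InX T w → NavierStokes.SolvesOn ν f v₀ T w →
      ∀ t ∈ Icc (0 : ℝ) T, ∀ x, v t x = w t x) ∧
    -- existence on `[0,T]`, as the limit of the iterations, if these are bounded in `X` there
    (∀ T : ℝ, 0 < T → (⨆ n, NavierStokes.N1 T (NavierStokes.iter ν f v₀ n)) < ⊤ →
      ∃ v : ℝ → NavierStokes.E3 → NavierStokes.E3,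
        NavierStokes.InX T v ∧ NavierStokes.SolvesOn ν f v₀ T v ∧
        Tendsto (fun n => NavierStokes.N0 T
          (fun t x => NavierStokes.iter ν f v₀ n t x - v t x)) atTop (𝓝 0)) ∧
    -- existence for all `t ≥ 0` if the iterations are bounded in `X` for every `T`
    ((∀ T : ℝ, 0 < T → (⨆ n, NavierStokes.N1 T (NavierStokes.iter ν f v₀ n)) < ⊤) →
      ∃ v : ℝ → NavierStokes.E3 → NavierStokes.E3,
        (∀ T : ℝ, 0 < T →
          NavierStokes.InX T v ∧ NavierStokes.SolvesOn ν f v₀ T v ∧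
          Tendsto (fun n => NavierStokes.N0 T
            (fun t x => NavierStokes.iter ν f v₀ n t x - v t x)) atTop (𝓝 0)) ∧
        ∀ t : ℝ, 0 ≤ t → NavierStokes.energy v t < ⊤) ∧
    -- every solution in `X` has finite energy
    (∀ T : ℝ, 0 < T → ∀ v : ℝ → NavierStokes.E3 → NavierStokes.E3,
      NavierStokes.InX T v → NavierStokes.SolvesOn ν f v₀ T v →
      ∀ t ∈ Icc (0 : ℝ) T, NavierStokes.energy v t < ⊤) := by
  obtain ⟨C₀, hC₀⟩ := hv₀_decay
  have hv₀b : ∀ x, ‖v₀ x‖ ≤ |C₀| * NavierStokes.weight 1 x ^ (2 : ℝ) := fun x =>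
    NavierStokes.rpow_neg_le_weight ha
      ((le_add_of_nonneg_right (norm_nonneg _)).trans (hC₀ x))
  have hfb : ∀ T : ℝ, 0 < T → ∃ A, 0 ≤ A ∧ ∀ t ∈ Icc (0 : ℝ) T, ∀ x,
      ‖f t x‖ ≤ A * NavierStokes.weight 1 x ^ (2 : ℝ) := fun T hT => by
    obtain ⟨C, hC⟩ := hf_decay T hT
    exact ⟨|C|, abs_nonneg _, fun t ht x => NavierStokes.rpow_neg_le_weight ha
      ((le_add_of_nonneg_right (norm_nonneg _)).trans (hC t ht x))⟩
  have hfm : ∀ T, NavierStokes.MeasurableOnSlab T f := fun T =>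
    ⟨fun p => f p.1 p.2, hf_meas, fun _ _ _ => rfl⟩
  have hlim : ∀ T : ℝ, 0 < T → (⨆ n, NavierStokes.N1 T (NavierStokes.iter ν f v₀ n)) < ⊤ →
      NavierStokes.InX T (NavierStokes.iterLimit ν f v₀) ∧
      NavierStokes.SolvesOn ν f v₀ T (NavierStokes.iterLimit ν f v₀) ∧
      Tendsto (fun n => NavierStokes.N0 T (fun t x => NavierStokes.iter ν f v₀ n t x -
        NavierStokes.iterLimit ν f v₀ t x)) atTop (𝓝 0) := fun T hT hN => by
    obtain ⟨A, hA, hf⟩ := hfb T hT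
    exact NavierStokes.iterLimit_spec hν (hfm T) hA hf hv₀ (abs_nonneg _) hv₀b hN
  have henergy : ∀ T : ℝ, 0 < T → ∀ v : ℝ → NavierStokes.E3 → NavierStokes.E3,
      NavierStokes.InX T v → NavierStokes.SolvesOn ν f v₀ T v →
      ∀ t ∈ Icc (0 : ℝ) T, NavierStokes.energy v t < ⊤ := fun T hT v hX hv t ht => by
    obtain ⟨A, hA, hf⟩ := hfb T hT
    exact hv.energy_lt_top hν hA hf (abs_nonneg _) hv₀b hX ht
  refine ⟨fun T _ v w hvX hv hwX hw => hv.unique hν hvX hwX hw,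
    fun T hT hN => ⟨_, hlim T hT hN⟩,
    fun hN => ⟨_, fun T hT => hlim T hT (hN T hT), fun t ht => ?_⟩, henergy⟩
  -- The interval `[0,t+1]` has positive length even at `t = 0`.
  have hT : 0 < t + 1 := by linarith
  have h := hlim (t + 1) hT (hN _ hT)
  exact henergy (t + 1) hT _ h.1 h.2.1 t ⟨ht, by linarith⟩
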